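/- **Setting.** Let $D\ge 0$, let $A_\mu(z)$, $\mu=1,\dots,D$, be smooth functions on $\mathbb R^D$ with values in complex matrices (a non-Abelian gauge field), let $D_\mu=\partial_\mu-iA_\mu$ be the covariant derivative in $z$, and let $F_{\mu\nu}=\partial_\mu A_\nu-\partial_\nu A_\mu-i[A_\mu,A_\nu]$, so that $[D_\mu,D_\nu]=-iF_{\mu\nu}$. Let $\star=e^{\frac i2(\overleftarrow\partial_x\overrightarrow\partial_p-\overleftarrow\partial_p\overrightarrow\partial_x)}$ be the ordinary Moyal product of symbols on phase space. For a temperate symbol $f$ and a Schwartz function $\varphi$ it is given by $$(f\star\varphi)(x,p)=(2\pi)^{-2D}\int dy'\,dk\,f(x-\tfrac{y'}2,k)\int dy\,dk'\,e^{-iy(k-p)-iy'(k'-p)}\varphi(x+\tfrac y2,k').$$ A multiplier is a smooth function of polynomial growth together with all its derivatives whose Moyal product with every Schwartz function is a Schwartz function. The product $h=f\star g$ of two multipliers is the multiplier with $h\star\varphi=f\star(g\star\varphi)$ for all Schwartz $\varphi$, if there is one. Let $\mathcal A$ be a linear space of multipliers that contains the constants and is closed under $\star$ and under all $\partial_{p_\mu}$.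 Let $Q(x,p)$ be a spinor-matrix-valued symbol (acting as the identity on gauge indices) with entries in $\mathcal A$, which has a two-sided Moyal inverse with entries in $\mathcal A$. The generalized Groenewold equation for $G_W(x,p,z)$, a matrix in spinor and gauge indices, is $$Q(x,p)\star\Bigl[e^{\frac i2(\partial_{p_1}+\partial_{p_2})D_z}\,e^{-i\partial_{p_1}D_z}\,e^{-\frac i2\partial_{p_2}D_z}\,G_W(x,p,z)\,e^{-\frac i2\partial_{p_2}D_z}\,e^{\frac i2(\partial_{p_1}+\partial_{p_2})D_z}\times 1\Bigr]=1,$$ where $\partial_{p_1}$ acts on $Q$, $\partial_{p_2}$ acts on $G_W$, every $D_z$ acts on everything to its right, and the exponentials are expanded in powers of $D_z$. A formal solution is a sequence $G_W=\sum_{n\ge0}G^{(n)}(x,p,z)$ which solves the equation in every order in $D_z$, with $G^{(n)}$ counted as of order $n$. Here each $G^{(n)}$ is smooth in $z$ and, for every fixed $z$, its entries and those of all its $z$-derivatives lie in $\mathcal A$. **Theorem.** The generalized Groenewold equation has exactly one formal solution. Each $G^{(n)}$ contains $n$ powers of $D_z$: it is a finite sum of terms $a(x,p)\otimes E(z)$,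 where $a$ is a spinor-matrix symbol with entries in $\mathcal A$ and $E$ is a monomial with exactly $n$ covariant derivatives, i.e. $E$ is built from the constant function $1$ by applying operators $D_\mu$ and multiplying. The zeroth order $G^{(0)}=G^{(0)}(x,p)$ is independent of $z$, proportional to the identity in the gauge indices, and solves $$Q\star G^{(0)}=1 .$$ Moreover $G^{(1)}=0$ and $$G^{(2)}(x,p,z)=-\frac i2\,G^{(0)}(x,p)\star\partial_{p_\mu}Q(x,p)\star\partial_{p_\nu}G^{(0)}(x,p)\,F_{\mu\nu}(z),$$ with summation over $\mu,\nu$. -/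

import Mathlib

open scoped Kronecker ContDiff SchwartzMap

noncomputable section

/-- Euclidean `D`-dimensional space (positions, momenta, and the gauge variable `z`). -/
abbrev Pos (D : ℕ) : Type := EuclideanSpace ℝ (Fin D)

/-- Phase space, with points `(x, p)`. -/
abbrev Phase (D : ℕ) : Type := Pos D × Pos D

/-- The coordinate direction `μ`. -/
def dir {D : ℕ} (μ : Fin D) : Pos D := EuclideanSpace.single μ (1 : ℝ)

/-! ### The ordinary Moyal product -/

/-- The ordinary star product of a symbol `f` with a rapidly decreasing function `φ`,
`(f ⋆ φ)(x,p) = (2π)^(-2D) ∫ dy' dk f(x - y'/2, k) ∫ dy dk' e^{-iy(k-p) - iy'(k'-p)} φ(x + y/2, k')`.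
For Schwartz `φ` the inner integral is a Schwartz function of `(y', k)`, so that both integrals
converge absolutely for every `f` of polynomial growth. Integrating out the four variables formally
gives `f exp((i/2)(∂ₓ← ∂ₚ→ - ∂ₚ← ∂ₓ→)) φ`. -/
def starAct {D : ℕ} (f φ : Phase D → ℂ) (u : Phase D) : ℂ :=
  (((2 * Real.pi) ^ (2 * D) : ℝ) : ℂ)⁻¹ *
    ∫ a : Pos D × Pos D, f (u.1 - (2⁻¹ : ℝ) • a.1, a.2) *
      ∫ b : Pos D × Pos D,
        Complex.exp (-Complex.I *
          ((inner ℝ b.1 (a.2 - u.2) + inner ℝ a.1 (b.2 - u.2) : ℝ) : ℂ)) *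
          φ (u.1 + (2⁻¹ : ℝ) • b.1, b.2)

/-- `f` is a (left) Moyal multiplier: a smooth function of polynomial growth such that `f ⋆ φ` is a
Schwartz function for every Schwartz function `φ`. -/
structure IsMoyalMultiplier {D : ℕ} (f : Phase D → ℂ) : Prop where
  temperate : Function.HasTemperateGrowth f
  maps : ∀ φ : 𝓢(Phase D, ℂ), ∃ ψ : 𝓢(Phase D, ℂ), ∀ u, ψ u = starAct f φ u

/-- `h` is the Moyal product `f ⋆ g` of two Moyal multipliers, that is, the symbol for which
`h ⋆ φ = f ⋆ (g ⋆ φ)` for all Schwartz functions `φ` (the symbol of the product of the two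
operators). There is at most one such `h`. -/
structure IsMoyalProduct {D : ℕ} (f g h : Phase D → ℂ) : Prop where
  left : IsMoyalMultiplier f
  right : IsMoyalMultiplier g
  prod : IsMoyalMultiplier h
  act : ∀ φ : 𝓢(Phase D, ℂ), starAct h φ = starAct f (starAct g φ)

open Classical in
/-- The Moyal product `f ⋆ g` of scalar symbols (`0` where it is not defined). -/
def moyal {D : ℕ} (f g : Phase D → ℂ) : Phase D → ℂ :=
  if h : ∃ k, IsMoyalProduct f g k then h.choose else 0

/-- The Moyal product of matrix-valued symbols. -/
def matMoyal {D : ℕ} {ι : Type*} [Fintype ι] (F H : Phase D → Matrix ι ι ℂ) :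
    Phase D → Matrix ι ι ℂ :=
  fun u => Matrix.of fun i k => ∑ j, moyal (fun v => F v i j) (fun v => H v j k) u

/-- The momentum derivative `∂_{p_μ}` of a scalar symbol. -/
def dpScalar {D : ℕ} (μ : Fin D) (f : Phase D → ℂ) : Phase D → ℂ :=
  fun u => lineDeriv ℝ (fun p => f (u.1, p)) u.2 (dir μ)

/-- The momentum derivative `∂_{p_μ}` of a matrix-valued symbol. -/
def dp {D : ℕ} {ι : Type*} (μ : Fin D) (F : Phase D → Matrix ι ι ℂ) : Phase D → Matrix ι ι ℂ :=
  fun u => Matrix.of fun i j => dpScalar μ (fun v => F v i j) u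

/-- Iterated momentum derivatives. -/
def dpWord {D : ℕ} {ι : Type*} (l : List (Fin D)) (F : Phase D → Matrix ι ι ℂ) :
    Phase D → Matrix ι ι ℂ :=
  l.foldr dp F

/-- `𝒜` is a star algebra of symbols: a linear space of Moyal multipliers that contains the
constants and is closed under the momentum derivatives and under the Moyal product. -/
structure IsSymbolAlgebra {D : ℕ} (𝒜 : Submodule ℂ (Phase D → ℂ)) : Prop where
  multiplier : ∀ f ∈ 𝒜, IsMoyalMultiplier f
  one_mem : (fun _ => 1) ∈ 𝒜
  dp_mem : ∀ f ∈ 𝒜, ∀ μ, dpScalar μ f ∈ 𝒜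
  star_mem : ∀ f ∈ 𝒜, ∀ g ∈ 𝒜, ∃ h ∈ 𝒜, IsMoyalProduct f g h

/-- The matrix-valued symbol `F` has its entries in `𝒜`. -/
def EntriesIn {D : ℕ} {ι : Type*} (𝒜 : Submodule ℂ (Phase D → ℂ))
    (F : Phase D → Matrix ι ι ℂ) : Prop :=
  ∀ i j, (fun u => F u i j) ∈ 𝒜

/-! ### Gauge field, covariant derivative, field strength -/

/-- The partial derivative `∂_μ` of a matrix-valued function of `z`. -/
def dzMat {D : ℕ} {ι : Type*} (μ : Fin D) (B : Pos D → Matrix ι ι ℂ) : Pos D → Matrix ι ι ℂ :=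
  fun z => Matrix.of fun i j => lineDeriv ℝ (fun w => B w i j) z (dir μ)

/-- A matrix-valued function of `z` with smooth entries. -/
def SmoothEntries {D : ℕ} {ι : Type*} (B : Pos D → Matrix ι ι ℂ) : Prop :=
  ∀ i j, ContDiff ℝ ∞ (fun z => B z i j)

/-- The gauge covariant derivative `D_μ = ∂_μ - i A_μ`, acting to the right. -/
def covD {D : ℕ} {ι : Type*} [Fintype ι] (A : Fin D → Pos D → Matrix ι ι ℂ) (μ : Fin D)
    (B : Pos D → Matrix ι ι ℂ) : Pos D → Matrix ι ι ℂ :=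
  fun z => dzMat μ B z - Complex.I • (A μ z * B z)

/-- The product `D_{μ₁} ⋯ D_{μₙ}` applied to a matrix-valued function of `z`. -/
def covDWord {D : ℕ} {ι : Type*} [Fintype ι] (A : Fin D → Pos D → Matrix ι ι ℂ)
    (l : List (Fin D)) (B : Pos D → Matrix ι ι ℂ) : Pos D → Matrix ι ι ℂ :=
  l.foldr (covD A) B

/-- The non-Abelian field strength, `[D_μ, D_ν] = -i F_{μν}`. -/
def fieldStrength {D : ℕ} {ι : Type*} [Fintype ι] (A : Fin D → Pos D → Matrix ι ι ℂ)
    (μ ν : Fin D) : Pos D → Matrix ι ι ℂ :=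
  fun z => dzMat μ (A ν) z - dzMat ν (A μ) z -
    Complex.I • (A μ z * A ν z - A ν z * A μ z)

/-- `E(z)` is a monomial containing exactly `n` covariant derivatives. -/
inductive IsDMonomial {D : ℕ} {ι : Type*} [Fintype ι] [DecidableEq ι]
    (A : Fin D → Pos D → Matrix ι ι ℂ) : ℕ → (Pos D → Matrix ι ι ℂ) → Prop
  | one : IsDMonomial A 0 (fun _ => 1)
  | cov {n : ℕ} {E : Pos D → Matrix ι ι ℂ} (μ : Fin D) (hE : IsDMonomial A n E) :
      IsDMonomial A (n + 1) (covD A μ E)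
  | mul {m n : ℕ} {E E' : Pos D → Matrix ι ι ℂ} (hE : IsDMonomial A m E)
      (hE' : IsDMonomial A n E') : IsDMonomial A (m + n) (fun z => E z * E' z)

/-! ### The generalized star product, order by order in the covariant derivative -/

/-- A gauge field acting on the tensor product of the spinor and the gauge indices. -/
def liftGauge {D : ℕ} (s : Type*) {g : Type*} [DecidableEq s]
    (A : Fin D → Pos D → Matrix g g ℂ) : Fin D → Pos D → Matrix (s × g) (s × g) ℂ :=
  fun μ z => (1 : Matrix s s ℂ) ⊗ₖ A μ z

/-- A spinor matrix symbol acting as the identity on the gauge indices. -/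
def liftSpin {D : ℕ} {s : Type*} (g : Type*) [DecidableEq g]
    (Q : Phase D → Matrix s s ℂ) : Phase D → Matrix (s × g) (s × g) ℂ :=
  fun u => Q u ⊗ₖ (1 : Matrix g g ℂ)

/-- The five exponents of the generalized star product are `(α ∂_{p₁} + β ∂_{p₂}) · D_z`, where
`∂_{p₁}` acts on `Q` (coefficient `α`, at `true`) and `∂_{p₂}` acts on `G` (coefficient `β`, at
`false`); see `starOrder`. -/
def expCoeff : Fin 5 → Bool → ℂ :=
  ![fun _ => Complex.I / 2,
    fun b => if b then -Complex.I else 0,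
    fun b => if b then 0 else -Complex.I / 2,
    fun b => if b then 0 else -Complex.I / 2,
    fun _ => Complex.I / 2]

/-- The directions of those letters of a word whose momentum derivative acts on `Q` (`b = true`),
or on `G` (`b = false`). -/
def pLetters {D : ℕ} (b : Bool) (l : List (Bool × Fin D)) : List (Fin D) :=
  (l.filter fun a => a.1 == b).map Prod.snd

/-- The part of order `n` in `D_z` of the generalized star product
`Q ⋆ [ e^{(i/2)(∂_{p₁}+∂_{p₂}) D_z} e^{-i ∂_{p₁} D_z} e^{-(i/2) ∂_{p₂} D_z} G(x,p,z)
  e^{-(i/2) ∂_{p₂} D_z} e^{(i/2)(∂_{p₁}+∂_{p₂}) D_z} × 1 ]`,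
in which `∂_{p₁}` acts on `Q`, `∂_{p₂}` acts on `G`, every `D_z` acts on everything to its right,
and `⋆` is the ordinary Moyal product in `(x,p)`. Here `e j` is the power taken from the `j`-th
exponential and `w j` is the word of letters (momentum derivative and direction) drawn from it. -/
def starOrder {D : ℕ} {s g : Type*} [Fintype s] [DecidableEq s] [Fintype g] [DecidableEq g]
    (n : ℕ) (A : Fin D → Pos D → Matrix g g ℂ) (Q : Phase D → Matrix s s ℂ)
    (G : Phase D → Pos D → Matrix (s × g) (s × g) ℂ) :
    Phase D → Pos D → Matrix (s × g) (s × g) ℂ :=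
  fun u z =>
    ∑ e ∈ Finset.Nat.antidiagonalTuple 5 n,
      ∑ w : (j : Fin 5) → Fin (e j) → Bool × Fin D,
        (∏ j, (((e j).factorial : ℂ)⁻¹ * ∏ k, expCoeff j (w j k).1)) •
          (let word : Fin 5 → List (Bool × Fin D) := fun j => List.ofFn (w j)
           let all := word 0 ++ word 1 ++ word 2 ++ word 3 ++ word 4
           let leftD := (word 0 ++ word 1 ++ word 2).map Prod.snd
           let rightD := (word 3 ++ word 4).map Prod.snd
           matMoyal
            (dpWord (pLetters true all) (liftSpin g Q))
            (dpWord (pLetters false all) fun v =>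
              covDWord (liftGauge s A) leftD
                (fun z' => G v z' * covDWord (liftGauge s A) rightD (fun _ => 1) z') z)
            u)

/-- The formal series `∑ₙ G⁽ⁿ⁾` solves the generalized Groenewold equation `Q ★ G = 1` in every
order `N` in `D_z`, where `G⁽ⁿ⁾` counts as order `n`. -/
def SolvesGroenewold {D : ℕ} {s g : Type*} [Fintype s] [DecidableEq s] [Fintype g] [DecidableEq g]
    (A : Fin D → Pos D → Matrix g g ℂ) (Q : Phase D → Matrix s s ℂ)
    (G : ℕ → Phase D → Pos D → Matrix (s × g) (s × g) ℂ) : Prop :=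
  ∀ N u z, ∑ nm ∈ Finset.HasAntidiagonal.antidiagonal N, starOrder nm.1 A Q (G nm.2) u z = if N = 0 then 1 else 0

/-- `H(x,p,z)` is smooth in `z`, and it and all its `z`-derivatives are symbols in `𝒜` at every
fixed `z`. -/
structure IsRegularFamily {D : ℕ} {ι : Type*} (𝒜 : Submodule ℂ (Phase D → ℂ))
    (H : Phase D → Pos D → Matrix ι ι ℂ) : Prop where
  smooth : ∀ u, SmoothEntries (H u)
  mem : ∀ (l : List (Fin D)) (z : Pos D), EntriesIn 𝒜 (fun u => l.foldr dzMat (H u) z)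

end

noncomputable section

/-! ### Symbols as operators on Schwartz functions. -/

section

open MeasureTheory FourierTransform

variable {D : ℕ}

/-! The equation is triangular in the order of `D_z`. The order-zero part of the generalized star
product is plain Moyal multiplication by `Q` (`starOrder_zero`), so order `N` reads `Q ⋆ G⁽ᴺ⁾ =
δ_{N0} -` (terms in `G⁽ᵏ⁾`, `k < N`). Multiplying by the Moyal inverse `R` on the left gives both
the recursion `groenewoldSolution` and uniqueness.

For this, `⋆` must be bilinear, associative and unital on `𝒜`. A symbol is determined by its action
on Schwartz functions (`eq_zero_of_starAct_eq_zero`), because the inner integral of `⋆` is, up to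
affine changes of variables, a Fourier transform, hence onto the Schwartz space. Identities between
symbols thus reduce to identities between operators.

The shape of `G⁽ⁿ⁾` comes from `a(x,p) ⊗ E(z)`: Moyal products and `∂_p` touch only `a`, covariant
derivatives only `E`, and the degrees add (`isDPolynomial_starOrder`).

For the low orders, on `R ⊗ 1` all `D_z` end up acting on `1`, so only concatenated words matter,
and the five exponentials multiply in a free algebra. With `a = ∂_{p₁}·D` and `b = ∂_{p₂}·D` the
exponents sum to zero, which kills order one; order two is then half the sum of their ordered
commutators, namely `-(1/2)[a,b]`. Since `[D_μ,D_ν] = -iF_{μν}`, this is `(i/2) ∂_μQ ⋆ ∂_νR F_{μν}`,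
and applying `-R ⋆` gives `G⁽²⁾`. -/

instance isAddHaarMeasure_volume_phase : (volume : Measure (Phase D)).IsAddHaarMeasure :=
  inferInstanceAs ((volume : Measure (Pos D)).prod (volume : Measure (Pos D))).IsAddHaarMeasure

/-- Rescaling of the integration variables of the inner integral of the star product. -/
def innerScale (D : ℕ) : WithLp 2 (Pos D × Pos D) ≃L[ℝ] Phase D :=
  (WithLp.prodContinuousLinearEquiv 2 ℝ (Pos D) (Pos D)).trans
    ((ContinuousLinearEquiv.smulLeft (Units.mk0 (2⁻¹ : ℝ) (by norm_num))).prodCongr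
      (ContinuousLinearEquiv.refl ℝ (Pos D)))

lemma innerScale_apply (v : WithLp 2 (Pos D × Pos D)) :
    innerScale D v = ((2⁻¹ : ℝ) • v.fst, v.snd) := rfl

/-- The frequency of the inner integral of the star product. -/
def outerScale (D : ℕ) : Phase D ≃L[ℝ] WithLp 2 (Pos D × Pos D) :=
  ((ContinuousLinearEquiv.smulLeft (Units.mk0 ((2 * Real.pi)⁻¹ : ℝ) (by positivity))).trans
    (ContinuousLinearEquiv.prodComm ℝ (Pos D) (Pos D))).trans
    (WithLp.prodContinuousLinearEquiv 2 ℝ (Pos D) (Pos D)).symm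

lemma outerScale_apply (a : Phase D) :
    outerScale D a = WithLp.toLp 2 (((2 * Real.pi)⁻¹ : ℝ) • a).swap := rfl

/-- The inner integral of the star product as a map of Schwartz functions. -/
def innerKernel (u : Phase D) (φ : 𝓢(Phase D, ℂ)) : 𝓢(Phase D, ℂ) :=
  SchwartzMap.compSubConstCLM ℂ (0, u.2)
    (SchwartzMap.compCLMOfContinuousLinearEquiv ℂ (outerScale D)
      (𝓕 (SchwartzMap.compCLMOfContinuousLinearEquiv ℂ (innerScale D)
        (SchwartzMap.compSubConstCLM ℂ (-u) φ))))

lemma innerKernel_add (u : Phase D) (φ ψ : 𝓢(Phase D, ℂ)) :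
    innerKernel u (φ + ψ) = innerKernel u φ + innerKernel u ψ := by
  simp only [innerKernel, map_add, FourierTransform.fourier_add]

lemma innerKernel_smul (u : Phase D) (c : ℂ) (φ : 𝓢(Phase D, ℂ)) :
    innerKernel u (c • φ) = c • innerKernel u φ := by
  simp only [innerKernel, map_smul, FourierTransform.fourier_smul]

/-- At fixed `u`, translations, linear changes of variables and `𝓕` are all bijections of the
Schwartz space; the preimage undoes them in reverse order. -/
lemma innerKernel_surjective (u : Phase D) : Function.Surjective (innerKernel u) := by
  intro ψ
  refine ⟨SchwartzMap.compSubConstCLM ℂ u (SchwartzMap.compCLMOfContinuousLinearEquiv ℂ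
    (innerScale D).symm (𝓕⁻ (SchwartzMap.compCLMOfContinuousLinearEquiv ℂ
      (outerScale D).symm (SchwartzMap.compSubConstCLM ℂ (-(0, u.2)) ψ)))), ?_⟩
  have h : SchwartzMap.compCLMOfContinuousLinearEquiv ℂ (innerScale D)
      (SchwartzMap.compSubConstCLM ℂ (-u) (SchwartzMap.compSubConstCLM ℂ u
        (SchwartzMap.compCLMOfContinuousLinearEquiv ℂ
          (innerScale D).symm (𝓕⁻ (SchwartzMap.compCLMOfContinuousLinearEquiv ℂ
      (outerScale D).symm (SchwartzMap.compSubConstCLM ℂ (-(0, u.2)) ψ)))))) =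
      (𝓕⁻ (SchwartzMap.compCLMOfContinuousLinearEquiv ℂ
      (outerScale D).symm (SchwartzMap.compSubConstCLM ℂ (-(0, u.2)) ψ))) := by
    ext v
    simp [SchwartzMap.compCLMOfContinuousLinearEquiv_apply]
  rw [innerKernel, h, FourierTransform.fourier_fourierInv_eq]
  ext v
  simp [SchwartzMap.compCLMOfContinuousLinearEquiv_apply, sub_sub, ← Prod.zero_eq_mk]

lemma innerKernel_eq_integral (u : Phase D) (φ : 𝓢(Phase D, ℂ)) (a : Phase D) :
    innerKernel u φ a = ∫ b : Pos D × Pos D,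
        Complex.exp (-Complex.I *
          ((inner ℝ b.1 (a.2 - u.2) + inner ℝ a.1 (b.2 - u.2) : ℝ) : ℂ)) *
          φ (u.1 + (2⁻¹ : ℝ) • b.1, b.2) := by
  -- Shifts `k'` by `p`, so that the phase becomes bilinear in the integration variable and the
  -- frequency.
  rw [← integral_add_right_eq_self _ ((0, u.2) : Phase D)]
  rw [← (WithLp.volume_preserving_ofLp (U := Pos D) (V := Pos D)).integral_comp
    (MeasurableEquiv.toLp 2 (Pos D × Pos D)).symm.measurableEmbedding]
  change 𝓕 (SchwartzMap.compCLMOfContinuousLinearEquiv ℂ (innerScale D)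
        (SchwartzMap.compSubConstCLM ℂ (-u) φ)) (outerScale D (a - (0, u.2))) = _
  rw [SchwartzMap.fourier_coe, Real.fourier_eq']
  refine integral_congr_ae (.of_forall fun v => ?_)
  simp only [smul_eq_mul, SchwartzMap.compCLMOfContinuousLinearEquiv_apply, Function.comp_apply,
    SchwartzMap.compSubConstCLM_apply, innerScale_apply, outerScale_apply]
  congr 1
  · congr 1
    simp only [WithLp.prod_inner_apply, Prod.fst_sub, Prod.snd_sub, Prod.fst_swap, Prod.snd_swap,
      Prod.smul_fst, Prod.smul_snd, Prod.fst_add, Prod.snd_add, inner_smul_right, sub_zero,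
      add_zero, add_sub_cancel_right]
    rw [real_inner_comm a.1]
    push_cast
    have : (Real.pi : ℂ) ≠ 0 := by exact_mod_cast Real.pi_ne_zero
    field_simp
  · congr 1
    ext1 <;> simp [add_comm]

lemma starAct_eq_integral_innerKernel (f : Phase D → ℂ) (φ : 𝓢(Phase D, ℂ)) (u : Phase D) :
    starAct f φ u = (((2 * Real.pi) ^ (2 * D) : ℝ) : ℂ)⁻¹ *
      ∫ a : Phase D, f (u.1 - (2⁻¹ : ℝ) • a.1, a.2) * innerKernel u φ a := by
  simp only [starAct, innerKernel_eq_integral]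

lemma Function.HasTemperateGrowth.integrable_mul_innerKernel {f : Phase D → ℂ}
    (hf : f.HasTemperateGrowth) (φ : 𝓢(Phase D, ℂ)) (u : Phase D) :
    Integrable fun a : Phase D => f (u.1 - (2⁻¹ : ℝ) • a.1, a.2) * innerKernel u φ a := by
  have h : Function.HasTemperateGrowth
      (fun a : Phase D => f (u.1 - (2⁻¹ : ℝ) • a.1, a.2)) := by
    let ℓ : Phase D →L[ℝ] Phase D :=
      ((-(2⁻¹ : ℝ)) • ContinuousLinearMap.fst ℝ (Pos D) (Pos D)).prod
        (ContinuousLinearMap.snd ℝ (Pos D) (Pos D))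
    have h2 : Function.HasTemperateGrowth (fun a : Phase D => ((u.1, 0) : Phase D) + ℓ a) :=
      (Function.HasTemperateGrowth.const _).add ℓ.hasTemperateGrowth
    convert hf.comp h2 using 2 with a
    simp only [Function.comp_apply]
    congr 1
    ext1 <;> simp [ℓ, sub_eq_add_neg]
  convert (SchwartzMap.smulLeftCLM ℂ (fun a : Phase D => f (u.1 - (2⁻¹ : ℝ) • a.1, a.2))
    (innerKernel u φ)).integrable (μ := volume) using 2 with a
  rw [SchwartzMap.smulLeftCLM_apply_apply h, smul_eq_mul]

lemma starAct_add_left {f g : Phase D → ℂ} (hf : f.HasTemperateGrowth)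
    (hg : g.HasTemperateGrowth) (φ : 𝓢(Phase D, ℂ)) :
    starAct (f + g) φ = starAct f φ + starAct g φ := by
  ext u
  simp only [Pi.add_apply, starAct_eq_integral_innerKernel, add_mul]
  rw [integral_add (hf.integrable_mul_innerKernel φ u) (hg.integrable_mul_innerKernel φ u), mul_add]

lemma starAct_smul_left (c : ℂ) (f : Phase D → ℂ) (φ : 𝓢(Phase D, ℂ)) :
    starAct (c • f) φ = c • starAct f φ := by
  ext u
  simp only [Pi.smul_apply, smul_eq_mul, starAct_eq_integral_innerKernel, mul_assoc]
  rw [integral_const_mul, mul_left_comm]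

lemma starAct_add_right {f : Phase D → ℂ} (hf : f.HasTemperateGrowth) (φ ψ : 𝓢(Phase D, ℂ)) :
    starAct f ⇑(φ + ψ) = starAct f φ + starAct f ψ := by
  ext u
  simp only [Pi.add_apply, starAct_eq_integral_innerKernel, innerKernel_add, add_apply,
    mul_add]
  rw [integral_add (hf.integrable_mul_innerKernel φ u) (hf.integrable_mul_innerKernel ψ u), mul_add]

lemma starAct_smul_right (c : ℂ) (f : Phase D → ℂ) (φ : 𝓢(Phase D, ℂ)) :
    starAct f ⇑(c • φ) = c • starAct f φ := by
  ext u
  simp only [Pi.smul_apply, smul_eq_mul, starAct_eq_integral_innerKernel, innerKernel_smul,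
    smul_apply, mul_left_comm _ c]
  rw [integral_const_mul, mul_left_comm]

/-- Fourier inversion: the constant symbol `1` acts as the identity. -/
lemma starAct_one (φ : 𝓢(Phase D, ℂ)) : starAct (fun _ => 1) φ = φ := by
  ext u
  rw [starAct_eq_integral_innerKernel]
  simp only [one_mul]
  set χ := SchwartzMap.compCLMOfContinuousLinearEquiv ℂ (innerScale D)
        (SchwartzMap.compSubConstCLM ℂ (-u) φ) with hχ
  have h1 : ∫ a : Phase D, innerKernel u φ a = ∫ a : Phase D, 𝓕 χ (outerScale D a) :=
    integral_sub_right_eq_self (fun a : Phase D => 𝓕 χ (outerScale D a)) ((0, u.2) : Phase D)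
  -- The Jacobian of the scaling by `(2π)⁻¹` in dimension `2D` is what the prefactor of `starAct`
  -- cancels.
  have h2 : ∫ a : Phase D, 𝓕 χ (outerScale D a) =
      (((2 * Real.pi) ^ (2 * D) : ℝ) : ℂ) * ∫ a : Phase D, 𝓕 χ (WithLp.toLp 2 a.swap) := by
    simp only [outerScale_apply]
    rw [Measure.integral_comp_smul volume (fun a : Phase D => 𝓕 χ (WithLp.toLp 2 a.swap))]
    have : Module.finrank ℝ (Phase D) = 2 * D := by simp [two_mul]
    rw [this, inv_pow, inv_inv, abs_of_nonneg (by positivity), Complex.real_smul]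
  have h3 : ∫ a : Phase D, 𝓕 χ (WithLp.toLp 2 a.swap) = ∫ v, 𝓕 χ v := by
    rw [← (WithLp.volume_preserving_toLp (U := Pos D) (V := Pos D)).integral_comp
      (MeasurableEquiv.toLp 2 (Pos D × Pos D)).measurableEmbedding]
    exact (Measure.measurePreserving_swap (μ := (volume : Measure (Pos D)))
      (ν := (volume : Measure (Pos D)))).integral_comp
      MeasurableEquiv.prodComm.measurableEmbedding (fun a : Phase D => 𝓕 χ (WithLp.toLp 2 a))
  have h4 : ∫ v, 𝓕 χ v = χ 0 := by
    conv_rhs => rw [← FourierTransform.fourierInv_fourier_eq (F := 𝓢(WithLp 2 (Pos D × Pos D), ℂ)) χ]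
    rw [SchwartzMap.fourierInv_coe, Real.fourierInv_eq']
    simp
  have h5 : χ 0 = φ u := by
    simp [hχ, SchwartzMap.compCLMOfContinuousLinearEquiv_apply]
  rw [h1, h2, h3, h4, h5, inv_mul_cancel_left₀]
  exact_mod_cast (pow_pos Real.two_pi_pos _).ne'

/-- A symbol is determined by its action on Schwartz functions. -/
lemma eq_zero_of_starAct_eq_zero {f : Phase D → ℂ} (hf : f.HasTemperateGrowth)
    (h : ∀ φ : 𝓢(Phase D, ℂ), starAct f φ = 0) : f = 0 := by
  have hc : Continuous f := hf.1.continuous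
  set F : Phase D → ℂ := fun a => f (-(2⁻¹ : ℝ) • a.1, a.2) with hF
  have hFc : Continuous F := by fun_prop
  have key : ∀ ψ : 𝓢(Phase D, ℂ), ∫ a : Phase D, F a * ψ a = 0 := by
    intro ψ
    -- Evaluation at the single point `u = 0` suffices: there `φ` already produces every Schwartz
    -- function.
    obtain ⟨φ, rfl⟩ := innerKernel_surjective (0 : Phase D) ψ
    have h0 := congrFun (h φ) 0
    rw [starAct_eq_integral_innerKernel, Pi.zero_apply, mul_eq_zero] at h0
    have hne : (((2 * Real.pi) ^ (2 * D) : ℝ) : ℂ)⁻¹ ≠ 0 :=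
      inv_ne_zero (by exact_mod_cast (pow_pos Real.two_pi_pos _).ne')
    simpa [hF] using h0.resolve_left hne
  have hae : ∀ᵐ a : Phase D, F a = 0 := by
    refine ae_eq_zero_of_integral_contDiff_smul_eq_zero hFc.locallyIntegrable fun g hg hgs => ?_
    have hs : HasCompactSupport (fun a => (g a : ℂ)) := hgs.comp_left Complex.ofReal_zero
    have := key (hs.toSchwartzMap (Complex.ofRealCLM.contDiff.comp hg))
    rw [← this]
    refine integral_congr_ae (.of_forall fun a => ?_)
    exact (Complex.real_smul).trans (mul_comm _ _)
  have hF0 : F = 0 := Continuous.ae_eq_iff_eq (volume : Measure (Phase D)) hFc continuous_const |>.1 hae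
  ext u
  have := congrFun hF0 (-(2 : ℝ) • u.1, u.2)
  simpa [hF, smul_smul] using this

end

/-! ### The Moyal algebra structure of `𝒜` and its matrix version. -/

section

variable {D : ℕ}

lemma IsMoyalProduct.unique {f g k k' : Phase D → ℂ} (h : IsMoyalProduct f g k)
    (h' : IsMoyalProduct f g k') : k = k' := by
  have hk' : Function.HasTemperateGrowth ((-1 : ℂ) • k') :=
    (Function.HasTemperateGrowth.const (-1 : ℂ)).smul h'.prod.temperate
  have h0 : k + (-1 : ℂ) • k' = 0 :=
    eq_zero_of_starAct_eq_zero (h.prod.temperate.add hk') fun φ => by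
      rw [starAct_add_left h.prod.temperate hk', starAct_smul_left, h.act, h'.act]
      simp
  rwa [neg_one_smul, ← sub_eq_add_neg, sub_eq_zero] at h0

lemma IsMoyalProduct.moyal_eq {f g k : Phase D → ℂ} (h : IsMoyalProduct f g k) :
    moyal f g = k := by
  have hex : ∃ k, IsMoyalProduct f g k := ⟨k, h⟩
  rw [moyal, dif_pos hex]
  exact hex.choose_spec.unique h

lemma IsMoyalMultiplier.exists_coe {f : Phase D → ℂ} (hf : IsMoyalMultiplier f)
    (φ : 𝓢(Phase D, ℂ)) : ∃ ψ : 𝓢(Phase D, ℂ), ⇑ψ = starAct f φ :=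
  (hf.maps φ).imp fun _ h => funext h

lemma matMoyal_entry {ι : Type*} [Fintype ι] (F H : Phase D → Matrix ι ι ℂ) (i k : ι) :
    (fun u => matMoyal F H u i k) =
      ∑ j, moyal (fun v => F v i j) (fun v => H v j k) := by
  ext u; simp [matMoyal]

namespace IsSymbolAlgebra

variable {𝒜 : Submodule ℂ (Phase D → ℂ)} (h𝒜 : IsSymbolAlgebra 𝒜)
include h𝒜

lemma temperate {f : Phase D → ℂ} (hf : f ∈ 𝒜) : f.HasTemperateGrowth :=
  (h𝒜.multiplier f hf).temperate

lemma isMoyalProduct_moyal {f g : Phase D → ℂ} (hf : f ∈ 𝒜) (hg : g ∈ 𝒜) :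
    IsMoyalProduct f g (moyal f g) := by
  obtain ⟨k, -, hk⟩ := h𝒜.star_mem f hf g hg
  rwa [hk.moyal_eq]

lemma moyal_mem {f g : Phase D → ℂ} (hf : f ∈ 𝒜) (hg : g ∈ 𝒜) : moyal f g ∈ 𝒜 := by
  obtain ⟨k, hkm, hk⟩ := h𝒜.star_mem f hf g hg
  rwa [hk.moyal_eq]

/-- The algebraic laws below are checked through this criterion, as identities between operators on
Schwartz functions. -/
lemma moyal_eq_of_starAct {f g k : Phase D → ℂ} (hf : f ∈ 𝒜) (hg : g ∈ 𝒜) (hk : k ∈ 𝒜)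
    (h : ∀ φ : 𝓢(Phase D, ℂ), starAct k φ = starAct f (starAct g φ)) : moyal f g = k :=
  IsMoyalProduct.moyal_eq
    ⟨h𝒜.multiplier f hf, h𝒜.multiplier g hg, h𝒜.multiplier k hk, h⟩

lemma starAct_moyal {f g : Phase D → ℂ} (hf : f ∈ 𝒜) (hg : g ∈ 𝒜) (φ : 𝓢(Phase D, ℂ)) :
    starAct (moyal f g) φ = starAct f (starAct g φ) :=
  (h𝒜.isMoyalProduct_moyal hf hg).act φ

lemma moyal_add_left {f f' g : Phase D → ℂ} (hf : f ∈ 𝒜) (hf' : f' ∈ 𝒜) (hg : g ∈ 𝒜) :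
    moyal (f + f') g = moyal f g + moyal f' g := by
  have h := h𝒜.moyal_mem hf hg
  have h' := h𝒜.moyal_mem hf' hg
  refine h𝒜.moyal_eq_of_starAct (add_mem hf hf') hg (add_mem h h') fun φ => ?_
  -- `g ⋆ φ` is replaced by a Schwartz function, since the laws for `starAct` are available only on
  -- such arguments.
  obtain ⟨ψ, hψ⟩ := (h𝒜.multiplier g hg).exists_coe φ
  rw [starAct_add_left (h𝒜.temperate h) (h𝒜.temperate h'), h𝒜.starAct_moyal hf hg,
    h𝒜.starAct_moyal hf' hg, ← hψ, starAct_add_left (h𝒜.temperate hf) (h𝒜.temperate hf')]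

lemma moyal_add_right {f g g' : Phase D → ℂ} (hf : f ∈ 𝒜) (hg : g ∈ 𝒜) (hg' : g' ∈ 𝒜) :
    moyal f (g + g') = moyal f g + moyal f g' := by
  have h := h𝒜.moyal_mem hf hg
  have h' := h𝒜.moyal_mem hf hg'
  refine h𝒜.moyal_eq_of_starAct hf (add_mem hg hg') (add_mem h h') fun φ => ?_
  obtain ⟨ψ, hψ⟩ := (h𝒜.multiplier g hg).exists_coe φ
  obtain ⟨ψ', hψ'⟩ := (h𝒜.multiplier g' hg').exists_coe φ
  rw [starAct_add_left (h𝒜.temperate h) (h𝒜.temperate h'), h𝒜.starAct_moyal hf hg,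
    h𝒜.starAct_moyal hf hg', starAct_add_left (h𝒜.temperate hg) (h𝒜.temperate hg'), ← hψ, ← hψ',
    ← starAct_add_right (h𝒜.temperate hf)]
  rfl

lemma moyal_smul_left (c : ℂ) {f g : Phase D → ℂ} (hf : f ∈ 𝒜) (hg : g ∈ 𝒜) :
    moyal (c • f) g = c • moyal f g := by
  have h := h𝒜.moyal_mem hf hg
  refine h𝒜.moyal_eq_of_starAct (𝒜.smul_mem c hf) hg (𝒜.smul_mem c h) fun φ => ?_
  obtain ⟨ψ, hψ⟩ := (h𝒜.multiplier g hg).exists_coe φ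
  rw [starAct_smul_left, h𝒜.starAct_moyal hf hg, ← hψ, starAct_smul_left]

lemma moyal_smul_right (c : ℂ) {f g : Phase D → ℂ} (hf : f ∈ 𝒜) (hg : g ∈ 𝒜) :
    moyal f (c • g) = c • moyal f g := by
  have h := h𝒜.moyal_mem hf hg
  refine h𝒜.moyal_eq_of_starAct hf (𝒜.smul_mem c hg) (𝒜.smul_mem c h) fun φ => ?_
  obtain ⟨ψ, hψ⟩ := (h𝒜.multiplier g hg).exists_coe φ
  rw [starAct_smul_left, h𝒜.starAct_moyal hf hg, starAct_smul_left, ← hψ, ← starAct_smul_right]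
  rfl

lemma moyal_zero_left {g : Phase D → ℂ} (hg : g ∈ 𝒜) : moyal 0 g = 0 := by
  simpa using h𝒜.moyal_smul_left 0 𝒜.zero_mem hg

lemma moyal_zero_right {f : Phase D → ℂ} (hf : f ∈ 𝒜) : moyal f 0 = 0 := by
  simpa using h𝒜.moyal_smul_right 0 hf 𝒜.zero_mem

lemma moyal_sum_left {κ : Type*} (S : Finset κ) {f : κ → Phase D → ℂ} {g : Phase D → ℂ}
    (hf : ∀ i ∈ S, f i ∈ 𝒜) (hg : g ∈ 𝒜) :
    moyal (∑ i ∈ S, f i) g = ∑ i ∈ S, moyal (f i) g := by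
  classical
  induction S using Finset.induction_on with
  | empty => simpa using h𝒜.moyal_zero_left hg
  | insert i S hi ih =>
    rw [Finset.sum_insert hi, Finset.sum_insert hi,
      h𝒜.moyal_add_left (hf i (by simp)) (sum_mem fun j hj => hf j (by simp [hj])) hg,
      ih fun j hj => hf j (by simp [hj])]

lemma moyal_sum_right {κ : Type*} (S : Finset κ) {f : Phase D → ℂ} {g : κ → Phase D → ℂ}
    (hf : f ∈ 𝒜) (hg : ∀ i ∈ S, g i ∈ 𝒜) :
    moyal f (∑ i ∈ S, g i) = ∑ i ∈ S, moyal f (g i) := by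
  classical
  induction S using Finset.induction_on with
  | empty => simpa using h𝒜.moyal_zero_right hf
  | insert i S hi ih =>
    rw [Finset.sum_insert hi, Finset.sum_insert hi,
      h𝒜.moyal_add_right hf (hg i (by simp)) (sum_mem fun j hj => hg j (by simp [hj])),
      ih fun j hj => hg j (by simp [hj])]

lemma moyal_assoc {f g k : Phase D → ℂ} (hf : f ∈ 𝒜) (hg : g ∈ 𝒜) (hk : k ∈ 𝒜) :
    moyal (moyal f g) k = moyal f (moyal g k) := by
  have h := h𝒜.moyal_mem hg hk
  refine h𝒜.moyal_eq_of_starAct (h𝒜.moyal_mem hf hg) hk (h𝒜.moyal_mem hf h) fun φ => ?_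
  obtain ⟨ψ, hψ⟩ := (h𝒜.multiplier k hk).exists_coe φ
  rw [h𝒜.starAct_moyal hf h, h𝒜.starAct_moyal hg hk, ← hψ, h𝒜.starAct_moyal hf hg]

lemma one_moyal {f : Phase D → ℂ} (hf : f ∈ 𝒜) : moyal (fun _ => 1) f = f := by
  refine h𝒜.moyal_eq_of_starAct h𝒜.one_mem hf hf fun φ => ?_
  obtain ⟨ψ, hψ⟩ := (h𝒜.multiplier f hf).exists_coe φ
  rw [← hψ, starAct_one]

section Matrix

variable {ι : Type*} [Fintype ι]

lemma entriesIn_matMoyal {F H : Phase D → Matrix ι ι ℂ} (hF : EntriesIn 𝒜 F)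
    (hH : EntriesIn 𝒜 H) : EntriesIn 𝒜 (matMoyal F H) := fun i k => by
  rw [matMoyal_entry]
  exact sum_mem fun j _ => h𝒜.moyal_mem (hF i j) (hH j k)

lemma matMoyal_assoc {F H K : Phase D → Matrix ι ι ℂ} (hF : EntriesIn 𝒜 F)
    (hH : EntriesIn 𝒜 H) (hK : EntriesIn 𝒜 K) :
    matMoyal (matMoyal F H) K = matMoyal F (matMoyal H K) := by
  ext u i l
  revert u
  -- Entries are compared as functions of `u`: the Moyal product is nonlocal, so it must be
  -- rewritten on whole symbols.
  rw [← funext_iff (f := fun u => _) (g := fun u => _), matMoyal_entry, matMoyal_entry]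
  simp only [matMoyal_entry]
  simp_rw [fun j => h𝒜.moyal_sum_left Finset.univ
      (fun k _ => h𝒜.moyal_mem (hF i k) (hH k j)) (hK j l),
    fun k => h𝒜.moyal_sum_right Finset.univ (hF i k) (fun j _ => h𝒜.moyal_mem (hH k j) (hK j l)),
    fun j k => h𝒜.moyal_assoc (hF i k) (hH k j) (hK j l)]
  exact Finset.sum_comm

lemma matMoyal_sum_right {κ : Type*} (S : Finset κ) {F : Phase D → Matrix ι ι ℂ}
    {H : κ → Phase D → Matrix ι ι ℂ} (hF : EntriesIn 𝒜 F) (hH : ∀ i ∈ S, EntriesIn 𝒜 (H i)) :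
    matMoyal F (fun u => ∑ i ∈ S, H i u) = fun u => ∑ i ∈ S, matMoyal F (H i) u := by
  ext u i l
  simp only [matMoyal, Matrix.of_apply, Matrix.sum_apply]
  rw [Finset.sum_comm]
  refine Finset.sum_congr rfl fun j _ => ?_
  rw [← Finset.sum_apply, ← h𝒜.moyal_sum_right S (hF i j) fun κ hκ => hH κ hκ j l]
  congr 2
  ext v
  simp

lemma matMoyal_smul_right (c : ℂ) {F H : Phase D → Matrix ι ι ℂ}
    (hF : EntriesIn 𝒜 F) (hH : EntriesIn 𝒜 H) :
    matMoyal F (fun u => c • H u) = fun u => c • matMoyal F H u := by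
  ext u i l
  simp only [matMoyal, Matrix.of_apply, Matrix.smul_apply, Finset.smul_sum]
  exact Finset.sum_congr rfl fun j _ => congrFun (h𝒜.moyal_smul_right c (hF i j) (hH j l)) u

/-- The gauge indices are inert under the Moyal product. -/
lemma matMoyal_liftSpin_kronecker {g : Type*} [Fintype g] [DecidableEq g]
    {F H : Phase D → Matrix ι ι ℂ} (hF : EntriesIn 𝒜 F) (hH : EntriesIn 𝒜 H)
    (E : Matrix g g ℂ) :
    matMoyal (liftSpin g F) (fun v => H v ⊗ₖ E) = fun u => matMoyal F H u ⊗ₖ E := by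
  ext u ⟨i, α⟩ ⟨l, γ⟩
  simp only [matMoyal, Matrix.of_apply, Matrix.kroneckerMap_apply, liftSpin, Fintype.sum_prod_type,
    Finset.sum_mul]
  refine Finset.sum_congr rfl fun j _ => ?_
  rw [Finset.sum_eq_single α]
  · have := h𝒜.moyal_smul_right (E α γ) (hF i j) (hH j l)
    simp only [Matrix.one_apply_eq, mul_one]
    rw [mul_comm, ← smul_eq_mul, ← Pi.smul_apply, ← this]
    congr 2
    ext v
    simp [mul_comm]
  · intro β _ hβ
    simp only [Matrix.one_apply_ne hβ.symm, mul_zero]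
    refine congrFun (h𝒜.moyal_zero_left ?_) u
    convert 𝒜.smul_mem (E β γ) (hH j l) using 1
    ext v
    simp [mul_comm]
  · simp

lemma one_matMoyal [DecidableEq ι] {F : Phase D → Matrix ι ι ℂ} (hF : EntriesIn 𝒜 F) :
    matMoyal (fun _ => 1) F = F := by
  ext u i l
  revert u
  rw [← funext_iff (f := fun u => _) (g := fun u => _), matMoyal_entry,
    Finset.sum_eq_single i]
  · simpa using h𝒜.one_moyal (hF i l)
  · intro j _ hj
    simp only [Matrix.one_apply_ne hj.symm]
    exact h𝒜.moyal_zero_left (hF j l)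
  · simp

end Matrix

end IsSymbolAlgebra

end

/-! ### Derivatives in `p` and `z` on sums of Kronecker products. -/

section

variable {D : ℕ}

/-- Serves both kinds of derivative: for `∂_p` the gauge factor is the constant, for `∂_z` the
spinor factor. -/
lemma Differentiable.lineDeriv_sum_mul_const {E κ : Type*} [NormedAddCommGroup E] [NormedSpace ℝ E]
    (S : Finset κ) {f : κ → E → ℂ} (c : κ → ℂ) (hf : ∀ j ∈ S, Differentiable ℝ (f j)) (x v : E) :
    lineDeriv ℝ (fun y => ∑ j ∈ S, f j y * c j) x v = ∑ j ∈ S, lineDeriv ℝ (f j) x v * c j := by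
  have h : ∀ j ∈ S, DifferentiableAt ℝ (fun t : ℝ => f j (x + t • v)) 0 := fun j hj =>
    (hf j hj).differentiableAt.comp (0 : ℝ) (by fun_prop)
  simp only [lineDeriv]
  rw [deriv_fun_sum fun j hj => (h j hj).mul_const (c j)]
  exact Finset.sum_congr rfl fun j hj => deriv_mul_const (h j hj) (c j)

namespace IsSymbolAlgebra

variable {𝒜 : Submodule ℂ (Phase D → ℂ)} (h𝒜 : IsSymbolAlgebra 𝒜) {ι : Type*}
include h𝒜

lemma entriesIn_dp {F : Phase D → Matrix ι ι ℂ} (hF : EntriesIn 𝒜 F) (μ : Fin D) :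
    EntriesIn 𝒜 (dp μ F) := fun i j => h𝒜.dp_mem _ (hF i j) μ

lemma entriesIn_dpWord {F : Phase D → Matrix ι ι ℂ} (hF : EntriesIn 𝒜 F) (l : List (Fin D)) :
    EntriesIn 𝒜 (dpWord l F) := by
  induction l with
  | nil => exact hF
  | cons μ l ih => exact h𝒜.entriesIn_dp ih μ

lemma dp_sum_kronecker {g κ : Type*} (S : Finset κ) {a : κ → Phase D → Matrix ι ι ℂ}
    (ha : ∀ j ∈ S, EntriesIn 𝒜 (a j)) (C : κ → Matrix g g ℂ) (μ : Fin D) :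
    dp μ (fun v => ∑ j ∈ S, a j v ⊗ₖ C j) = fun v => ∑ j ∈ S, dp μ (a j) v ⊗ₖ C j := by
  ext u ⟨i, α⟩ ⟨k, γ⟩
  simp only [dp, dpScalar, Matrix.of_apply, Matrix.sum_apply, Matrix.kroneckerMap_apply]
  refine Differentiable.lineDeriv_sum_mul_const S (fun j => C j α γ) (fun j hj => ?_) u.2 (dir μ)
  have := (h𝒜.temperate (ha j hj i k)).1.differentiable (by simp)
  exact this.comp (by fun_prop : Differentiable ℝ fun p : Pos D => (u.1, p))

lemma dpWord_sum_kronecker {g κ : Type*} (S : Finset κ) {a : κ → Phase D → Matrix ι ι ℂ}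
    (ha : ∀ j ∈ S, EntriesIn 𝒜 (a j)) (C : κ → Matrix g g ℂ) (l : List (Fin D)) :
    dpWord l (fun v => ∑ j ∈ S, a j v ⊗ₖ C j) = fun v => ∑ j ∈ S, dpWord l (a j) v ⊗ₖ C j := by
  induction l with
  | nil => rfl
  | cons μ l ih =>
    change dp μ (dpWord l _) = _
    rw [ih]
    exact h𝒜.dp_sum_kronecker S (fun j hj => h𝒜.entriesIn_dpWord (ha j hj) l) C μ

lemma dpWord_liftSpin {g : Type*} [DecidableEq g] {F : Phase D → Matrix ι ι ℂ}
    (hF : EntriesIn 𝒜 F) (l : List (Fin D)) :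
    dpWord l (liftSpin g F) = liftSpin g (dpWord l F) := by
  change dpWord l (fun v => F v ⊗ₖ 1) = fun v => dpWord l F v ⊗ₖ 1
  simpa using h𝒜.dpWord_sum_kronecker (g := g) (Finset.univ : Finset Unit)
    (a := fun _ => F) (fun _ _ => hF) (fun _ => 1) l

end IsSymbolAlgebra

/-! ### Derivatives in `z` -/

section Gauge

variable {ι s g : Type*}

lemma SmoothEntries.dzMat {B : Pos D → Matrix ι ι ℂ} (hB : SmoothEntries B) (μ : Fin D) :
    SmoothEntries (dzMat μ B) := fun i j => by
  have h : (fun z => _root_.dzMat μ B z i j) = fun z => fderiv ℝ (fun w => B w i j) z (dir μ) := by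
    ext z
    exact ((hB i j).differentiable (by simp) z).lineDeriv_eq_fderiv
  rw [h]
  exact ((hB i j).fderiv_right (m := ∞) le_rfl).clm_apply contDiff_const

lemma SmoothEntries.foldr_dzMat {B : Pos D → Matrix ι ι ℂ} (hB : SmoothEntries B)
    (l : List (Fin D)) : SmoothEntries (l.foldr _root_.dzMat B) := by
  induction l with
  | nil => exact hB
  | cons μ l ih => exact ih.dzMat μ

lemma SmoothEntries.mul [Fintype ι] {B C : Pos D → Matrix ι ι ℂ} (hB : SmoothEntries B)
    (hC : SmoothEntries C) : SmoothEntries fun z => B z * C z := fun i j => by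
  simp only [Matrix.mul_apply]
  exact ContDiff.sum fun k _ => (hB i k).mul (hC k j)

lemma SmoothEntries.const (C : Matrix ι ι ℂ) : SmoothEntries fun _ : Pos D => C :=
  fun _ _ => contDiff_const

lemma SmoothEntries.covD [Fintype ι] {A : Fin D → Pos D → Matrix ι ι ℂ}
    (hA : ∀ μ, SmoothEntries (A μ)) {B : Pos D → Matrix ι ι ℂ} (hB : SmoothEntries B) (μ : Fin D) :
    SmoothEntries (covD A μ B) := fun i j =>
  (hB.dzMat μ i j).sub (((hA μ).mul hB i j).const_smul Complex.I)

lemma SmoothEntries.covDWord [Fintype ι] {A : Fin D → Pos D → Matrix ι ι ℂ}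
    (hA : ∀ μ, SmoothEntries (A μ)) {B : Pos D → Matrix ι ι ℂ} (hB : SmoothEntries B)
    (l : List (Fin D)) : SmoothEntries (covDWord A l B) := by
  induction l with
  | nil => exact hB
  | cons μ l ih => exact ih.covD hA μ

lemma IsDMonomial.smoothEntries [Fintype g] [DecidableEq g] {A : Fin D → Pos D → Matrix g g ℂ}
    (hA : ∀ μ, SmoothEntries (A μ)) {n : ℕ} {E : Pos D → Matrix g g ℂ} (hE : IsDMonomial A n E) :
    SmoothEntries E := by
  induction hE with
  | one => exact .const 1
  | cov μ _ ih => exact ih.covD hA μ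
  | mul _ _ ih ih' => exact ih.mul ih'

lemma IsDMonomial.covDWord [Fintype g] [DecidableEq g] {A : Fin D → Pos D → Matrix g g ℂ}
    {n : ℕ} {E : Pos D → Matrix g g ℂ} (hE : IsDMonomial A n E) (l : List (Fin D)) :
    IsDMonomial A (n + l.length) (covDWord A l E) := by
  induction l with
  | nil => exact hE
  | cons μ l ih => exact ih.cov μ

lemma dzMat_sum_kronecker {κ : Type*} (S : Finset κ) (C : κ → Matrix s s ℂ)
    {E : κ → Pos D → Matrix g g ℂ} (hE : ∀ j ∈ S, SmoothEntries (E j)) (μ : Fin D) :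
    dzMat μ (fun z => ∑ j ∈ S, C j ⊗ₖ E j z) = fun z => ∑ j ∈ S, C j ⊗ₖ dzMat μ (E j) z := by
  ext z ⟨i, α⟩ ⟨k, γ⟩
  simp only [dzMat, Matrix.of_apply, Matrix.sum_apply, Matrix.kroneckerMap_apply]
  simp only [mul_comm (C _ i k)]
  exact Differentiable.lineDeriv_sum_mul_const S (fun j => C j i k)
    (fun j hj => (hE j hj α γ).differentiable (by simp)) z (dir μ)

lemma foldr_dzMat_sum_kronecker {κ : Type*} (S : Finset κ) (C : κ → Matrix s s ℂ)
    {E : κ → Pos D → Matrix g g ℂ} (hE : ∀ j ∈ S, SmoothEntries (E j)) (l : List (Fin D)) :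
    l.foldr dzMat (fun z => ∑ j ∈ S, C j ⊗ₖ E j z) =
      fun z => ∑ j ∈ S, C j ⊗ₖ l.foldr dzMat (E j) z := by
  induction l with
  | nil => rfl
  | cons μ l ih =>
    rw [List.foldr_cons, ih]
    exact dzMat_sum_kronecker S C (fun j hj => (hE j hj).foldr_dzMat l) μ

variable [Fintype s] [DecidableEq s] [Fintype g]

lemma covD_sum_kronecker {κ : Type*} (S : Finset κ) (A : Fin D → Pos D → Matrix g g ℂ)
    (C : κ → Matrix s s ℂ) {E : κ → Pos D → Matrix g g ℂ} (hE : ∀ j ∈ S, SmoothEntries (E j))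
    (μ : Fin D) :
    covD (liftGauge s A) μ (fun z => ∑ j ∈ S, C j ⊗ₖ E j z) =
      fun z => ∑ j ∈ S, C j ⊗ₖ covD A μ (E j) z := by
  ext1 z
  simp only [covD, dzMat_sum_kronecker S C hE, liftGauge, Finset.mul_sum, Finset.smul_sum,
    ← Matrix.mul_kronecker_mul, one_mul]
  rw [← Finset.sum_sub_distrib]
  refine Finset.sum_congr rfl fun j _ => ?_
  rw [sub_eq_add_neg, sub_eq_add_neg, Matrix.kronecker_add, ← neg_smul, ← neg_smul,
    Matrix.kronecker_smul]

lemma covDWord_sum_kronecker {κ : Type*} (S : Finset κ) {A : Fin D → Pos D → Matrix g g ℂ}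
    (hA : ∀ μ, SmoothEntries (A μ)) (C : κ → Matrix s s ℂ) {E : κ → Pos D → Matrix g g ℂ}
    (hE : ∀ j ∈ S, SmoothEntries (E j)) (l : List (Fin D)) :
    covDWord (liftGauge s A) l (fun z => ∑ j ∈ S, C j ⊗ₖ E j z) =
      fun z => ∑ j ∈ S, C j ⊗ₖ covDWord A l (E j) z := by
  induction l with
  | nil => rfl
  | cons μ l ih =>
    change covD _ μ (covDWord _ l _) = _
    rw [ih]
    exact covD_sum_kronecker S A C (fun j hj => (hE j hj).covDWord hA l) μ

lemma covDWord_liftGauge_one [DecidableEq g] {A : Fin D → Pos D → Matrix g g ℂ}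
    (hA : ∀ μ, SmoothEntries (A μ)) (l : List (Fin D)) :
    covDWord (liftGauge s A) l (fun _ => 1) = fun z => 1 ⊗ₖ covDWord A l (fun _ => 1) z := by
  simpa using covDWord_sum_kronecker (s := s) (Finset.univ : Finset Unit) hA (fun _ => 1)
    (E := fun _ _ => 1) (fun _ _ => .const 1) l

end Gauge

end

/-! ### Polynomials in the covariant derivative and the recursion for the solution. -/

section

variable {D : ℕ} {s g : Type*}

lemma IsRegularFamily.entriesIn {ι : Type*} {𝒜 : Submodule ℂ (Phase D → ℂ)}
    {H : Phase D → Pos D → Matrix ι ι ℂ} (hH : IsRegularFamily 𝒜 H) (z : Pos D) :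
    EntriesIn 𝒜 fun u => H u z := hH.mem [] z

lemma EntriesIn.liftSpin [DecidableEq g] {𝒜 : Submodule ℂ (Phase D → ℂ)} {F : Phase D → Matrix s s ℂ}
    (hF : EntriesIn 𝒜 F) : EntriesIn 𝒜 (liftSpin g F) := by
  rintro ⟨i, α⟩ ⟨k, γ⟩
  convert 𝒜.smul_mem ((1 : Matrix g g ℂ) α γ) (hF i k) using 1
  ext u
  simp [_root_.liftSpin, mul_comm]

variable [Fintype g] [DecidableEq g]

/-- `H(x,p,z)` is a finite sum of terms `a(x,p) ⊗ E(z)`, with the entries of `a` in `𝒜` and `E` a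
monomial with `n` covariant derivatives. -/
def IsDPolynomial (𝒜 : Submodule ℂ (Phase D → ℂ)) (A : Fin D → Pos D → Matrix g g ℂ) (n : ℕ)
    (H : Phase D → Pos D → Matrix (s × g) (s × g) ℂ) : Prop :=
  ∃ (κ : Type) (_ : Fintype κ) (a : κ → Phase D → Matrix s s ℂ) (E : κ → Pos D → Matrix g g ℂ),
    (∀ j, EntriesIn 𝒜 (a j)) ∧ (∀ j, IsDMonomial A n (E j)) ∧
      ∀ u z, H u z = ∑ j, a j u ⊗ₖ E j z

namespace IsDPolynomial

variable {𝒜 : Submodule ℂ (Phase D → ℂ)} {A : Fin D → Pos D → Matrix g g ℂ} {n : ℕ}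

lemma zero : IsDPolynomial 𝒜 A n (fun _ _ => (0 : Matrix (s × g) (s × g) ℂ)) :=
  ⟨Empty, inferInstance, Empty.elim, Empty.elim, fun j => j.elim, fun j => j.elim, by simp⟩

lemma add {H K : Phase D → Pos D → Matrix (s × g) (s × g) ℂ} (hH : IsDPolynomial 𝒜 A n H)
    (hK : IsDPolynomial 𝒜 A n K) : IsDPolynomial 𝒜 A n (fun u z => H u z + K u z) := by
  obtain ⟨κ, _, a, E, ha, hE, h⟩ := hH
  obtain ⟨κ', _, a', E', ha', hE', h'⟩ := hK
  refine ⟨κ ⊕ κ', inferInstance, Sum.elim a a', Sum.elim E E', ?_, ?_, fun u z => ?_⟩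
  · rintro (j | j)
    exacts [ha j, ha' j]
  · rintro (j | j)
    exacts [hE j, hE' j]
  · simp [h, h']

lemma sum {κ : Type*} (S : Finset κ) {H : κ → Phase D → Pos D → Matrix (s × g) (s × g) ℂ}
    (hH : ∀ i ∈ S, IsDPolynomial 𝒜 A n (H i)) :
    IsDPolynomial 𝒜 A n (fun u z => ∑ i ∈ S, H i u z) := by
  classical
  induction S using Finset.induction_on with
  | empty => simpa using zero
  | insert i S hi ih =>
    simp only [Finset.sum_insert hi]
    exact (hH i (by simp)).add (ih fun j hj => hH j (by simp [hj]))

lemma smul (c : ℂ) {H : Phase D → Pos D → Matrix (s × g) (s × g) ℂ}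
    (hH : IsDPolynomial 𝒜 A n H) : IsDPolynomial 𝒜 A n (fun u z => c • H u z) := by
  obtain ⟨κ, _, a, E, ha, hE, h⟩ := hH
  refine ⟨κ, inferInstance, fun j => c • a j, E, fun j i k => 𝒜.smul_mem c (ha j i k), hE,
    fun u z => ?_⟩
  simp [h, Finset.smul_sum, Matrix.smul_kronecker]

/-- All `z`-derivatives fall on the smooth factors `E`, leaving at fixed `z` a linear combination of
entries of the `a j`. This places the constructed solution in the class where uniqueness holds. -/
lemma isRegularFamily (hA : ∀ μ, SmoothEntries (A μ))
    {H : Phase D → Pos D → Matrix (s × g) (s × g) ℂ} (hH : IsDPolynomial 𝒜 A n H) :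
    IsRegularFamily 𝒜 H := by
  obtain ⟨κ, _, a, E, ha, hE, h⟩ := hH
  have hEs : ∀ j ∈ Finset.univ, SmoothEntries (E j) := fun j _ => (hE j).smoothEntries hA
  have hH : H = fun u z => ∑ j, a j u ⊗ₖ E j z := by ext1 u; ext1 z; exact h u z
  constructor
  · intro u
    rintro ⟨i, α⟩ ⟨k, γ⟩
    simp only [h, Matrix.sum_apply, Matrix.kroneckerMap_apply]
    exact ContDiff.sum fun j hj => contDiff_const.mul (hEs j hj α γ)
  · rintro l z ⟨i, α⟩ ⟨k, γ⟩
    simp only [hH, foldr_dzMat_sum_kronecker Finset.univ _ hEs, Matrix.sum_apply,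
      Matrix.kroneckerMap_apply]
    convert 𝒜.sum_mem (t := Finset.univ)
      fun j _ => 𝒜.smul_mem (l.foldr dzMat (E j) z α γ) (ha j i k) using 1
    ext u
    simp [mul_comm]

lemma exists_fin {H : Phase D → Pos D → Matrix (s × g) (s × g) ℂ} (hH : IsDPolynomial 𝒜 A n H) :
    ∃ (m : ℕ) (a : Fin m → Phase D → Matrix s s ℂ) (E : Fin m → Pos D → Matrix g g ℂ),
      (∀ j, EntriesIn 𝒜 (a j)) ∧ (∀ j, IsDMonomial A n (E j)) ∧
        ∀ u z, H u z = ∑ j, a j u ⊗ₖ E j z := by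
  obtain ⟨κ, _, a, E, ha, hE, h⟩ := hH
  let e := Fintype.equivFin κ
  refine ⟨_, fun j => a (e.symm j), fun j => E (e.symm j), fun j => ha _, fun j => hE _,
    fun u z => ?_⟩
  rw [h]
  exact (e.symm.sum_comp fun j => a j u ⊗ₖ E j z).symm

end IsDPolynomial

variable [Fintype s]

namespace IsSymbolAlgebra

variable {𝒜 : Submodule ℂ (Phase D → ℂ)} (h𝒜 : IsSymbolAlgebra 𝒜)
include h𝒜

lemma matMoyal_liftSpin_sum_kronecker {κ : Type*} (S : Finset κ) {F : Phase D → Matrix s s ℂ}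
    {a : κ → Phase D → Matrix s s ℂ} (hF : EntriesIn 𝒜 F) (ha : ∀ j ∈ S, EntriesIn 𝒜 (a j))
    (C : κ → Matrix g g ℂ) :
    matMoyal (liftSpin g F) (fun v => ∑ j ∈ S, a j v ⊗ₖ C j) =
      fun u => ∑ j ∈ S, matMoyal F (a j) u ⊗ₖ C j := by
  rw [h𝒜.matMoyal_sum_right S hF.liftSpin]
  · ext1 u
    exact Finset.sum_congr rfl fun j hj =>
      congrFun (h𝒜.matMoyal_liftSpin_kronecker hF (ha j hj) (C j)) u
  · rintro j hj ⟨i, α⟩ ⟨k, γ⟩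
    convert 𝒜.smul_mem (C j α γ) (ha j hj i k) using 1
    ext u
    simp [mul_comm]

/-- The Moyal product with a spinor symbol, at fixed `z`. -/
lemma isDPolynomial_matMoyal {A : Fin D → Pos D → Matrix g g ℂ} {n : ℕ}
    {F : Phase D → Matrix s s ℂ} (hF : EntriesIn 𝒜 F)
    {H : Phase D → Pos D → Matrix (s × g) (s × g) ℂ} (hH : IsDPolynomial 𝒜 A n H) :
    IsDPolynomial 𝒜 A n (fun u z => matMoyal (liftSpin g F) (fun v => H v z) u) := by
  obtain ⟨κ, _, a, E, ha, hE, h⟩ := hH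
  refine ⟨κ, inferInstance, fun j => matMoyal F (a j), E,
    fun j => h𝒜.entriesIn_matMoyal hF (ha j), hE, fun u z => ?_⟩
  simp only [h]
  rw [h𝒜.matMoyal_liftSpin_sum_kronecker Finset.univ hF fun j _ => ha j]

variable [DecidableEq s]

/-- Used in both directions: `R` cancels `Q` for uniqueness, `Q` cancels `R` for existence. -/
lemma matMoyal_liftSpin_cancel {Q R : Phase D → Matrix s s ℂ} (hQ : EntriesIn 𝒜 Q)
    (hR : EntriesIn 𝒜 R) (hRQ : matMoyal R Q = fun _ => 1)
    {H : Phase D → Matrix (s × g) (s × g) ℂ} (hH : EntriesIn 𝒜 H) :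
    matMoyal (liftSpin g R) (matMoyal (liftSpin g Q) H) = H := by
  rw [← h𝒜.matMoyal_assoc hR.liftSpin hQ.liftSpin hH]
  have : matMoyal (liftSpin g R) (liftSpin g Q) = fun _ => 1 := by
    have h := h𝒜.matMoyal_liftSpin_kronecker hR hQ (1 : Matrix g g ℂ)
    rw [hRQ] at h
    change matMoyal (liftSpin g R) (fun v => Q v ⊗ₖ 1) = _
    simpa using h
  rw [this, h𝒜.one_matMoyal hH]

variable {A : Fin D → Pos D → Matrix g g ℂ} (hA : ∀ μ, SmoothEntries (A μ))
include hA

/-- A single term of the generalized star product, on a sum of products `a(x,p) ⊗ E(z)`. -/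
lemma matMoyal_dpWord_covDWord {κ : Type*} [Fintype κ] {Q : Phase D → Matrix s s ℂ}
    (hQ : EntriesIn 𝒜 Q) {a : κ → Phase D → Matrix s s ℂ} (ha : ∀ j, EntriesIn 𝒜 (a j))
    {E : κ → Pos D → Matrix g g ℂ} (hE : ∀ j, SmoothEntries (E j)) (l₁ l₂ L R : List (Fin D))
    (z : Pos D) :
    matMoyal (dpWord l₁ (liftSpin g Q))
      (dpWord l₂ fun v => covDWord (liftGauge s A) L
        (fun z' => (∑ j, a j v ⊗ₖ E j z') * covDWord (liftGauge s A) R (fun _ => 1) z') z) =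
      fun u => ∑ j, matMoyal (dpWord l₁ Q) (dpWord l₂ (a j)) u ⊗ₖ
        covDWord A L (fun z' => E j z' * covDWord A R (fun _ => 1) z') z := by
  have h1 : SmoothEntries (covDWord A R (fun _ => 1)) := (SmoothEntries.const 1).covDWord hA R
  simp only [covDWord_liftGauge_one hA, Finset.sum_mul, ← Matrix.mul_kronecker_mul, mul_one]
  simp only [covDWord_sum_kronecker Finset.univ hA _ fun j _ => (hE j).mul h1]
  rw [h𝒜.dpWord_liftSpin hQ, h𝒜.dpWord_sum_kronecker Finset.univ fun j _ => ha j]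
  rw [h𝒜.matMoyal_liftSpin_sum_kronecker Finset.univ (h𝒜.entriesIn_dpWord hQ l₁)
    fun j _ => h𝒜.entriesIn_dpWord (ha j) l₂]

lemma isDPolynomial_starOrder {Q : Phase D → Matrix s s ℂ} (hQ : EntriesIn 𝒜 Q) (n : ℕ) {m : ℕ}
    {H : Phase D → Pos D → Matrix (s × g) (s × g) ℂ} (hH : IsDPolynomial 𝒜 A m H) :
    IsDPolynomial 𝒜 A (n + m) (starOrder n A Q H) := by
  obtain ⟨κ, _, a, E, ha, hE, h⟩ := hH
  have hH : H = fun u z => ∑ j, a j u ⊗ₖ E j z := by ext1 u; ext1 z; exact h u z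
  subst hH
  refine .sum _ fun e he => .sum _ fun w _ => .smul _ ?_
  rw [Finset.Nat.mem_antidiagonalTuple] at he
  dsimp only
  simp only [h𝒜.matMoyal_dpWord_covDWord hA hQ ha fun j => (hE j).smoothEntries hA]
  refine ⟨κ, inferInstance, _, fun j => covDWord A _ fun z' => E j z' * covDWord A _ _ z',
    fun j => h𝒜.entriesIn_matMoyal (h𝒜.entriesIn_dpWord hQ _) (h𝒜.entriesIn_dpWord (ha j) _),
    fun j => ?_, fun u z => rfl⟩
  -- Each letter of the five words contributes one derivative, to the right or to the left group, so
  -- the degree rises by `∑ e j = n`.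
  convert ((hE j).mul (IsDMonomial.one.covDWord _)).covDWord _ using 1
  simp only [List.length_map, List.length_append, List.length_ofFn, ← he, Fin.sum_univ_five]
  omega

end IsSymbolAlgebra

variable [DecidableEq s]

/-- Only the empty word remains, so the unknown of highest order enters through an invertible
operator. -/
lemma starOrder_zero (A : Fin D → Pos D → Matrix g g ℂ) (Q : Phase D → Matrix s s ℂ)
    (H : Phase D → Pos D → Matrix (s × g) (s × g) ℂ) (u : Phase D) (z : Pos D) :
    starOrder 0 A Q H u z = matMoyal (liftSpin g Q) (fun v => H v z) u := by
  simp [starOrder, Finset.Nat.antidiagonalTuple_zero_right, pLetters, dpWord, covDWord]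

/-- The formal solution, by recursion on the order. -/
def groenewoldSolution (A : Fin D → Pos D → Matrix g g ℂ) (Q R : Phase D → Matrix s s ℂ) :
    ℕ → Phase D → Pos D → Matrix (s × g) (s × g) ℂ
  | 0 => fun u _ => R u ⊗ₖ 1
  -- The sum runs over `Fin (N + 1)` so that each `k` carries the bound needed for termination.
  | N + 1 => fun u z => (-1 : ℂ) • matMoyal (liftSpin g R)
      (fun v => ∑ k : Fin (N + 1),
        starOrder (N + 1 - k) A Q (groenewoldSolution A Q R k) v z) u

/-! ### Existence and uniqueness, order by order. -/

section Solution

variable {𝒜 : Submodule ℂ (Phase D → ℂ)} (h𝒜 : IsSymbolAlgebra 𝒜)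
  {A : Fin D → Pos D → Matrix g g ℂ} (hA : ∀ μ, SmoothEntries (A μ))
  {Q R : Phase D → Matrix s s ℂ} (hQ : EntriesIn 𝒜 Q) (hR : EntriesIn 𝒜 R)

include h𝒜 hA hQ hR

lemma isDPolynomial_groenewoldSolution (N : ℕ) :
    IsDPolynomial 𝒜 A N (groenewoldSolution A Q R N) := by
  induction N using Nat.strong_induction_on with
  | _ N ih =>
    cases N with
    | zero =>
      rw [groenewoldSolution]
      exact ⟨Unit, inferInstance, fun _ => R, fun _ _ => 1, fun _ => hR, fun _ => .one, by simp⟩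
    | succ N =>
      rw [groenewoldSolution]
      refine .smul _ (h𝒜.isDPolynomial_matMoyal hR (.sum _ fun k _ => ?_))
      have := h𝒜.isDPolynomial_starOrder hA hQ (N + 1 - k) (ih k k.2)
      rwa [Nat.sub_add_cancel k.2.le] at this

lemma solvesGroenewold_groenewoldSolution (hQR : matMoyal Q R = fun _ => 1) :
    SolvesGroenewold A Q (groenewoldSolution A Q R) := by
  intro N u z
  have hsum : IsDPolynomial 𝒜 A N fun v z => ∑ k : Fin N,
      starOrder (N - k) A Q (groenewoldSolution A Q R k) v z := by
    refine .sum _ fun k _ => ?_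
    have := h𝒜.isDPolynomial_starOrder hA hQ (N - k)
      (isDPolynomial_groenewoldSolution h𝒜 hA hQ hR k)
    rwa [Nat.sub_add_cancel k.2.le] at this
  have hmem := (hsum.isRegularFamily hA).entriesIn z
  -- Ordering the sum by the order of `G` makes its last term the plain Moyal product of `Q` with
  -- `G⁽ᴺ⁾`.
  rw [← Finset.Nat.sum_antidiagonal_swap, Finset.Nat.sum_antidiagonal_eq_sum_range_succ_mk]
  simp only [Prod.fst_swap, Prod.snd_swap]
  rw [Finset.sum_range_succ, Nat.sub_self, starOrder_zero, Finset.sum_range]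
  cases N with
  | zero =>
    rw [groenewoldSolution, h𝒜.matMoyal_liftSpin_kronecker hQ hR, hQR]
    simp
  | succ N =>
    rw [groenewoldSolution,
      h𝒜.matMoyal_smul_right _ hQ.liftSpin (h𝒜.entriesIn_matMoyal hR.liftSpin hmem),
      h𝒜.matMoyal_liftSpin_cancel hR hQ hQR hmem]
    simp

omit hA in
lemma SolvesGroenewold.eq_of_isRegularFamily (hRQ : matMoyal R Q = fun _ => 1)
    {G G' : ℕ → Phase D → Pos D → Matrix (s × g) (s × g) ℂ}
    (hG : ∀ n, IsRegularFamily 𝒜 (G n)) (hG' : ∀ n, IsRegularFamily 𝒜 (G' n))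
    (h : SolvesGroenewold A Q G) (h' : SolvesGroenewold A Q G') : G' = G := by
  ext1 N
  induction N using Nat.strong_induction_on with
  | _ N ih =>
    have key : ∀ u z, matMoyal (liftSpin g Q) (fun v => G' N v z) u =
        matMoyal (liftSpin g Q) (fun v => G N v z) u := by
      intro u z
      have e := (h' N u z).trans (h N u z).symm
      rw [← Finset.Nat.sum_antidiagonal_swap, Finset.Nat.sum_antidiagonal_eq_sum_range_succ_mk,
        ← Finset.Nat.sum_antidiagonal_swap, Finset.Nat.sum_antidiagonal_eq_sum_range_succ_mk] at e
      simp only [Prod.fst_swap, Prod.snd_swap] at e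
      rw [Finset.sum_range_succ, Finset.sum_range_succ, Nat.sub_self, starOrder_zero,
        starOrder_zero, Finset.sum_congr rfl fun k hk => by rw [ih k (Finset.mem_range.1 hk)]] at e
      exact add_left_cancel e
    ext1 u
    ext1 z
    have e := congrArg (fun H => matMoyal (liftSpin g R) H u) (funext fun v => key v z)
    simpa only [h𝒜.matMoyal_liftSpin_cancel hQ hR hRQ ((hG N).entriesIn z),
      h𝒜.matMoyal_liftSpin_cancel hQ hR hRQ ((hG' N).entriesIn z)] using e

end Solution

end

section

/-! ### Sums over words -/

section Words

variable {α : Type*}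

/-- A word as an element of the algebra of noncommutative polynomials. -/
def wordMonomial (l : List α) : MonoidAlgebra ℂ (FreeMonoid α) :=
  MonoidAlgebra.of ℂ _ (FreeMonoid.ofList l)

lemma wordMonomial_append (l l' : List α) :
    wordMonomial (l ++ l') = wordMonomial l * wordMonomial l' := by
  rw [wordMonomial, wordMonomial, wordMonomial, ← map_mul]
  rfl

/-- The linear extension of a function of words to noncommutative polynomials. -/
def wordLift {V : Type*} [AddCommGroup V] [Module ℂ V] (T : List α → V) :
    MonoidAlgebra ℂ (FreeMonoid α) →ₗ[ℂ] V :=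
  (Finsupp.linearCombination ℂ fun w : FreeMonoid α => T w.toList) ∘ₗ
    (MonoidAlgebra.coeffLinearEquiv ℂ).toLinearMap

lemma wordLift_wordMonomial {V : Type*} [AddCommGroup V] [Module ℂ V] (T : List α → V)
    (l : List α) : wordLift T (wordMonomial l) = T l := by
  simp [wordLift, wordMonomial]

variable [Fintype α]

/-- The linear form `∑ₐ c(a) a` in the letters. -/
def letterSum (c : α → ℂ) : MonoidAlgebra ℂ (FreeMonoid α) := ∑ a, c a • wordMonomial [a]

/-- Noncommutative expansion of a power: each word occurs once, weighted by the product of the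
coefficients of its letters. -/
lemma letterSum_pow (c : α → ℂ) (n : ℕ) :
    letterSum c ^ n = ∑ w : Fin n → α, (∏ k, c (w k)) • wordMonomial (List.ofFn w) := by
  induction n with
  | zero => simp [wordMonomial, MonoidAlgebra.one_def]
  | succ n ih =>
    rw [pow_succ', ih, letterSum, ← (Fin.consEquiv fun _ => α).sum_comp, Fintype.sum_prod_type,
      Finset.sum_mul_sum]
    refine Finset.sum_congr rfl fun a _ => Finset.sum_congr rfl fun w _ => ?_
    rw [smul_mul_smul_comm, ← wordMonomial_append]
    simp [Fin.consEquiv, Fin.prod_univ_succ, List.ofFn_succ]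

lemma Fintype.sum_pi_fin_five {β : Fin 5 → Type*} [∀ j, Fintype (β j)] {V : Type*}
    [AddCommMonoid V] (F : β 0 → β 1 → β 2 → β 3 → β 4 → V) :
    ∑ w : (j : Fin 5) → β j, F (w 0) (w 1) (w 2) (w 3) (w 4) =
      ∑ a, ∑ b, ∑ c, ∑ d, ∑ e, F a b c d e := by
  let f : ((j : Fin 5) → β j) ≃ β 0 × β 1 × β 2 × β 3 × β 4 :=
    { toFun := fun w => (w 0, w 1, w 2, w 3, w 4)
      invFun := fun p => Fin.cons p.1 (Fin.cons p.2.1 (Fin.cons p.2.2.1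
        (Fin.cons p.2.2.2.1 (Fin.cons p.2.2.2.2 fun j => j.elim0))))
      left_inv := fun w => by ext j; fin_cases j <;> rfl
      right_inv := fun p => rfl }
  refine (f.sum_comp fun p => F p.1 p.2.1 p.2.2.1 p.2.2.2.1 p.2.2.2.2).trans ?_
  simp only [Fintype.sum_prod_type]

/-- Turns the sums over words in `starOrder` into a computation with five linear forms in the free
algebra, valid for any linear-space-valued function `T` of the concatenated word. -/
lemma sum_words_eq_wordLift {V : Type*} [AddCommGroup V] [Module ℂ V] (T : List α → V)
    (c : Fin 5 → α → ℂ) (e : Fin 5 → ℕ) :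
    ∑ w : (j : Fin 5) → Fin (e j) → α,
      (∏ j, (((e j).factorial : ℂ)⁻¹ * ∏ k, c j (w j k))) •
        T (List.ofFn (w 0) ++ List.ofFn (w 1) ++ List.ofFn (w 2) ++ List.ofFn (w 3) ++
          List.ofFn (w 4)) =
      (∏ j, ((e j).factorial : ℂ)⁻¹) • wordLift T
        (letterSum (c 0) ^ e 0 * (letterSum (c 1) ^ e 1 * (letterSum (c 2) ^ e 2 *
          (letterSum (c 3) ^ e 3 * letterSum (c 4) ^ e 4)))) := by
  simp only [Finset.prod_mul_distrib, mul_smul, ← Finset.smul_sum]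
  congr 1
  simp only [Fin.prod_univ_five]
  rw [Fintype.sum_pi_fin_five (β := fun j => Fin (e j) → α) fun w₀ w₁ w₂ w₃ w₄ =>
    ((∏ k, c 0 (w₀ k)) * (∏ k, c 1 (w₁ k)) * (∏ k, c 2 (w₂ k)) * (∏ k, c 3 (w₃ k)) *
      ∏ k, c 4 (w₄ k)) • T (List.ofFn w₀ ++ List.ofFn w₁ ++ List.ofFn w₂ ++ List.ofFn w₃ ++
        List.ofFn w₄)]
  simp only [letterSum_pow, Finset.sum_mul]
  simp only [Finset.mul_sum, map_sum, smul_mul_smul_comm, ← wordMonomial_append, map_smul,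
    wordLift_wordMonomial, mul_assoc, List.append_assoc]

end Words

/-! ### Orders one and two of the product of five exponentials. -/

section Exponents

variable {D : ℕ}

/-- The sum `∑_μ` of the letters with momentum derivative `b`. -/
def dirSum (D : ℕ) (b : Bool) : MonoidAlgebra ℂ (FreeMonoid (Bool × Fin D)) :=
  ∑ μ, wordMonomial [(b, μ)]

lemma letterSum_bool (c : Bool → ℂ) :
    letterSum (fun a : Bool × Fin D => c a.1) = c true • dirSum D true + c false • dirSum D false := by
  simp [letterSum, Fintype.sum_prod_type, dirSum, Finset.smul_sum]

lemma sum_antidiagonalTuple_five_one {V : Type*} [AddCommMonoid V] (F : (Fin 5 → ℕ) → V) :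
    ∑ e ∈ Finset.Nat.antidiagonalTuple 5 1, F e =
      F ![1,0,0,0,0] + F ![0,1,0,0,0] + F ![0,0,1,0,0] + F ![0,0,0,1,0] + F ![0,0,0,0,1] := by
  have : Finset.Nat.antidiagonalTuple 5 1 =
    {![1,0,0,0,0], ![0,1,0,0,0], ![0,0,1,0,0], ![0,0,0,1,0], ![0,0,0,0,1]} := by decide
  rw [this]
  repeat rw [Finset.sum_insert (by decide)]
  simp only [Finset.sum_singleton, add_assoc]

lemma sum_antidiagonalTuple_five_two {V : Type*} [AddCommMonoid V] (F : (Fin 5 → ℕ) → V) :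
    ∑ e ∈ Finset.Nat.antidiagonalTuple 5 2, F e =
      F ![2,0,0,0,0] + F ![0,2,0,0,0] + F ![0,0,2,0,0] + F ![0,0,0,2,0] + F ![0,0,0,0,2] +
      F ![1,1,0,0,0] + F ![1,0,1,0,0] + F ![1,0,0,1,0] + F ![1,0,0,0,1] +
      F ![0,1,1,0,0] + F ![0,1,0,1,0] + F ![0,1,0,0,1] +
      F ![0,0,1,1,0] + F ![0,0,1,0,1] + F ![0,0,0,1,1] := by
  have : Finset.Nat.antidiagonalTuple 5 2 =
    {![2,0,0,0,0], ![0,2,0,0,0], ![0,0,2,0,0], ![0,0,0,2,0], ![0,0,0,0,2],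
      ![1,1,0,0,0], ![1,0,1,0,0], ![1,0,0,1,0], ![1,0,0,0,1], ![0,1,1,0,0], ![0,1,0,1,0],
      ![0,1,0,0,1], ![0,0,1,1,0], ![0,0,1,0,1], ![0,0,0,1,1]} := by decide
  rw [this]
  repeat rw [Finset.sum_insert (by decide)]
  simp only [Finset.sum_singleton, add_assoc]

lemma sum_words_one {V : Type*} [AddCommGroup V] [Module ℂ V] (T : List (Bool × Fin D) → V) :
    ∑ e ∈ Finset.Nat.antidiagonalTuple 5 1, ∑ w : (j : Fin 5) → Fin (e j) → Bool × Fin D,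
      (∏ j, (((e j).factorial : ℂ)⁻¹ * ∏ k, expCoeff j (w j k).1)) •
        T (List.ofFn (w 0) ++ List.ofFn (w 1) ++ List.ofFn (w 2) ++ List.ofFn (w 3) ++
          List.ofFn (w 4)) = 0 := by
  simp only [fun e => sum_words_eq_wordLift T (fun j (a : Bool × Fin D) => expCoeff j a.1) e,
    letterSum_bool]
  rw [sum_antidiagonalTuple_five_one]
  simp only [Fin.prod_univ_five, ← map_smul, ← map_add]
  convert map_zero (wordLift T)
  -- The coefficients sum to `i/2 - i + i/2 = 0` for `∂_{p₁}` and `i/2 - i/2 - i/2 + i/2 = 0` for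
  -- `∂_{p₂}`.
  simp [expCoeff]
  module

lemma sum_words_two {V : Type*} [AddCommGroup V] [Module ℂ V] (T : List (Bool × Fin D) → V) :
    ∑ e ∈ Finset.Nat.antidiagonalTuple 5 2, ∑ w : (j : Fin 5) → Fin (e j) → Bool × Fin D,
      (∏ j, (((e j).factorial : ℂ)⁻¹ * ∏ k, expCoeff j (w j k).1)) •
        T (List.ofFn (w 0) ++ List.ofFn (w 1) ++ List.ofFn (w 2) ++ List.ofFn (w 3) ++
          List.ofFn (w 4)) =
      (-(1 / 2) : ℂ) • ∑ μ, ∑ ν, (T [(true, μ), (false, ν)] - T [(false, ν), (true, μ)]) := by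
  simp only [fun e => sum_words_eq_wordLift T (fun j (a : Bool × Fin D) => expCoeff j a.1) e,
    letterSum_bool]
  rw [sum_antidiagonalTuple_five_two]
  simp only [Fin.prod_univ_five, ← map_smul, ← map_add]
  have h : (-(1 / 2) : ℂ) • ∑ μ, ∑ ν, (T [(true, μ), (false, ν)] - T [(false, ν), (true, μ)]) =
      wordLift T ((-(1 / 2) : ℂ) •
        (dirSum D true * dirSum D false - dirSum D false * dirSum D true)) := by
    rw [map_smul, map_sub]
    simp only [dirSum, Finset.sum_mul_sum, ← wordMonomial_append, map_sum, wordLift_wordMonomial,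
      List.singleton_append]
    rw [Finset.sum_comm (f := fun ν μ => T [(false, ν), (true, μ)])]
    simp only [Finset.sum_sub_distrib]
  rw [h]
  congr 1
  -- What remains is an identity between quadratic polynomials in two noncommuting variables: the
  -- squares cancel and `ab`, `ba` keep `∓1/2`.
  generalize dirSum D true = a
  generalize dirSum D false = b
  simp [expCoeff, pow_two, mul_add, add_mul, smul_smul, smul_add]
  match_scalars <;> ring_nf <;> simp only [Complex.I_sq] <;> ring

end Exponents

end

/-! ### Field strength and the first two corrections. -/

section

variable {D : ℕ} {s g : Type*} [Fintype g] [DecidableEq g]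

/-- `[D_μ, D_ν] = -i F_{μν}`, on the constant function `1`. -/
lemma covD_covD_one_sub {A : Fin D → Pos D → Matrix g g ℂ} (hA : ∀ μ, SmoothEntries (A μ))
    (μ ν : Fin D) (z : Pos D) :
    covD A μ (covD A ν fun _ => 1) z - covD A ν (covD A μ fun _ => 1) z =
      -Complex.I • fieldStrength A μ ν z := by
  have h1 : ∀ μ, covD A μ (fun _ => 1) = fun z => -Complex.I • A μ z := fun μ => by
    ext z i j
    simp [covD, dzMat, lineDeriv]
  have h2 : ∀ μ ν, dzMat μ (fun z => -Complex.I • A ν z) z = -Complex.I • dzMat μ (A ν) z :=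
    fun μ ν => by
      ext i j
      have := Differentiable.lineDeriv_sum_mul_const (Finset.univ : Finset Unit)
        (f := fun _ w => A ν w i j) (fun _ => -Complex.I)
        (fun _ _ => (hA ν i j).differentiable (by simp)) z (dir μ)
      simpa [dzMat, mul_comm] using this
  simp only [h1]
  simp only [covD, h2, fieldStrength, Matrix.mul_smul, smul_sub, smul_smul]
  simp only [neg_mul, mul_neg, Complex.I_mul_I, neg_neg, one_smul, neg_smul]
  abel

variable [Fintype s]

/-- The contribution of a word of letters to the star product with a `z`-independent symbol. -/
def wordTerm (A : Fin D → Pos D → Matrix g g ℂ) (Q R : Phase D → Matrix s s ℂ) (u : Phase D)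
    (z : Pos D) (l : List (Bool × Fin D)) : Matrix (s × g) (s × g) ℂ :=
  matMoyal (dpWord (pLetters true l) Q) (dpWord (pLetters false l) R) u ⊗ₖ
    covDWord A (l.map Prod.snd) (fun _ => 1) z

variable [DecidableEq s]

lemma groenewoldSolution_succ (A : Fin D → Pos D → Matrix g g ℂ) (Q R : Phase D → Matrix s s ℂ)
    (N : ℕ) (u : Phase D) (z : Pos D) :
    groenewoldSolution A Q R (N + 1) u z = (-1 : ℂ) • matMoyal (liftSpin g R)
      (fun v => ∑ k ∈ Finset.range (N + 1),
        starOrder (N + 1 - k) A Q (groenewoldSolution A Q R k) v z) u := by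
  rw [groenewoldSolution]
  simp only [Finset.sum_range]

variable {𝒜 : Submodule ℂ (Phase D → ℂ)} (h𝒜 : IsSymbolAlgebra 𝒜)
  {A : Fin D → Pos D → Matrix g g ℂ} (hA : ∀ μ, SmoothEntries (A μ))
  {Q R : Phase D → Matrix s s ℂ} (hQ : EntriesIn 𝒜 Q)

include h𝒜 hA hQ

/-- The zero symbol is a sum of products `a ⊗ E` over an empty index type, so the general term
formula applies. -/
lemma starOrder_zero_right (n : ℕ) :
    starOrder n A Q (fun _ _ => (0 : Matrix (s × g) (s × g) ℂ)) = fun _ _ => 0 := by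
  ext1 u
  ext1 z
  have h := h𝒜.matMoyal_dpWord_covDWord (κ := Empty) hA hQ (a := Empty.elim) (fun j => j.elim)
    (E := Empty.elim) (fun j => j.elim)
  simp only [Finset.univ_eq_empty, Finset.sum_empty] at h
  simp only [starOrder, h, smul_zero, Finset.sum_const_zero]

variable (hR : EntriesIn 𝒜 R)
include hR

/-- On a symbol that does not depend on `z`, only the concatenated word of covariant derivatives
matters. -/
lemma starOrder_kronecker_one (n : ℕ) (u : Phase D) (z : Pos D) :
    starOrder n A Q (fun v _ => R v ⊗ₖ 1) u z =
      ∑ e ∈ Finset.Nat.antidiagonalTuple 5 n, ∑ w : (j : Fin 5) → Fin (e j) → Bool × Fin D,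
        (∏ j, (((e j).factorial : ℂ)⁻¹ * ∏ k, expCoeff j (w j k).1)) •
          wordTerm A Q R u z
            (List.ofFn (w 0) ++ List.ofFn (w 1) ++ List.ofFn (w 2) ++ List.ofFn (w 3) ++
              List.ofFn (w 4)) := by
  have h := h𝒜.matMoyal_dpWord_covDWord (κ := Unit) hA hQ (fun _ => hR)
    (E := fun _ _ => 1) (fun _ => .const 1)
  simp only [Finset.univ_unique, Finset.sum_singleton, one_mul] at h
  simp only [starOrder, h]
  refine Finset.sum_congr rfl fun e _ => Finset.sum_congr rfl fun w _ => ?_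
  simp only [wordTerm, covDWord, ← List.foldr_append, ← List.map_append, List.append_assoc]

lemma starOrder_one_kronecker_one (u : Phase D) (z : Pos D) :
    starOrder 1 A Q (fun v _ => R v ⊗ₖ 1) u z = 0 := by
  rw [starOrder_kronecker_one h𝒜 hA hQ hR]
  exact sum_words_one _

lemma starOrder_two_kronecker_one (u : Phase D) (z : Pos D) :
    starOrder 2 A Q (fun v _ => R v ⊗ₖ 1) u z =
      ∑ μ, ∑ ν, matMoyal (dp μ Q) (dp ν R) u ⊗ₖ ((Complex.I / 2) • fieldStrength A μ ν z) := by
  rw [starOrder_kronecker_one h𝒜 hA hQ hR]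
  refine (sum_words_two _).trans ?_
  simp only [Finset.smul_sum]
  refine Finset.sum_congr rfl fun μ _ => Finset.sum_congr rfl fun ν _ => ?_
  -- The two words put the same momentum derivatives on `Q` and `R` and differ only in the order of
  -- `D_μ` and `D_ν`, whence a commutator.
  change (-(1 / 2) : ℂ) • (matMoyal (dp μ Q) (dp ν R) u ⊗ₖ covD A μ (covD A ν fun _ => 1) z -
    matMoyal (dp μ Q) (dp ν R) u ⊗ₖ covD A ν (covD A μ fun _ => 1) z) = _
  have hsub : ∀ (M : Matrix s s ℂ) (B C : Matrix g g ℂ), M ⊗ₖ B - M ⊗ₖ C = M ⊗ₖ (B - C) := by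
    intro M B C
    ext
    simp [mul_sub]
  rw [hsub, covD_covD_one_sub hA, ← Matrix.kronecker_smul, smul_smul]
  congr 2
  ring

lemma groenewoldSolution_one : groenewoldSolution A Q R 1 = fun _ _ => 0 := by
  ext1 u
  ext1 z
  rw [groenewoldSolution_succ]
  simp only [zero_add, Finset.sum_range_one, Nat.sub_zero]
  rw [show groenewoldSolution A Q R 0 = fun v _ => R v ⊗ₖ 1 by rw [groenewoldSolution]]
  simp only [starOrder_one_kronecker_one h𝒜 hA hQ hR]
  have := h𝒜.matMoyal_liftSpin_sum_kronecker (g := g) (∅ : Finset Unit) hR (a := fun _ => R)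
    (by simp) (fun _ => 1)
  simp only [Finset.sum_empty] at this
  rw [this, smul_zero]

lemma groenewoldSolution_two (u : Phase D) (z : Pos D) :
    groenewoldSolution A Q R 2 u z = -(Complex.I / 2) • ∑ μ, ∑ ν,
      matMoyal R (matMoyal (dp μ Q) (dp ν R)) u ⊗ₖ fieldStrength A μ ν z := by
  rw [groenewoldSolution_succ]
  -- Of the two lower contributions, order one acting on `G⁽¹⁾ = 0` drops out, and only order two
  -- acting on `R ⊗ 1` is left.
  simp only [Finset.sum_range_succ, Finset.sum_range_zero, zero_add, Nat.reduceAdd, Nat.sub_zero,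
    Nat.reduceSub, groenewoldSolution_one h𝒜 hA hQ hR, starOrder_zero_right h𝒜 hA hQ, add_zero]
  rw [show groenewoldSolution A Q R 0 = fun v _ => R v ⊗ₖ 1 by rw [groenewoldSolution]]
  simp only [starOrder_two_kronecker_one h𝒜 hA hQ hR]
  simp only [← Finset.sum_product']
  rw [h𝒜.matMoyal_liftSpin_sum_kronecker (Finset.univ ×ˢ Finset.univ) hR
    (a := fun x : Fin D × Fin D => matMoyal (dp x.1 Q) (dp x.2 R))
    (fun x _ => h𝒜.entriesIn_matMoyal (h𝒜.entriesIn_dp hQ _) (h𝒜.entriesIn_dp hR _))]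
  simp only [Finset.sum_product, Matrix.kronecker_smul, ← Finset.smul_sum, smul_smul]
  congr 1
  ring

end

end

theorem theorem9 {D : ℕ} {s g : Type*} [Fintype s] [DecidableEq s] [Fintype g] [DecidableEq g]
    (𝒜 : Submodule ℂ (Phase D → ℂ)) (h𝒜 : IsSymbolAlgebra 𝒜)
    (Q : Phase D → Matrix s s ℂ) (hQ : EntriesIn 𝒜 Q)
    (hinv : ∃ R : Phase D → Matrix s s ℂ, EntriesIn 𝒜 R ∧
      matMoyal Q R = (fun _ => 1) ∧ matMoyal R Q = (fun _ => 1))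
    (A : Fin D → Pos D → Matrix g g ℂ) (hA : ∀ μ, SmoothEntries (A μ)) :
    ∃ G : ℕ → Phase D → Pos D → Matrix (s × g) (s × g) ℂ,
      (∀ n, IsRegularFamily 𝒜 (G n)) ∧ SolvesGroenewold A Q G ∧
      (∀ G' : ℕ → Phase D → Pos D → Matrix (s × g) (s × g) ℂ,
        (∀ n, IsRegularFamily 𝒜 (G' n)) → SolvesGroenewold A Q G' → G' = G) ∧
      (∀ n, ∃ (m : ℕ) (a : Fin m → Phase D → Matrix s s ℂ) (E : Fin m → Pos D → Matrix g g ℂ),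
        (∀ j, EntriesIn 𝒜 (a j)) ∧ (∀ j, IsDMonomial A n (E j)) ∧
        ∀ u z, G n u z = ∑ j, a j u ⊗ₖ E j z) ∧
      ∃ G₀ : Phase D → Matrix s s ℂ, EntriesIn 𝒜 G₀ ∧
        (∀ u z, G 0 u z = G₀ u ⊗ₖ (1 : Matrix g g ℂ)) ∧
        matMoyal Q G₀ = (fun _ => 1) ∧
        (∀ u z, G 1 u z = 0) ∧
        (∀ u z, G 2 u z =
          -(Complex.I / 2) • ∑ μ, ∑ ν,
            matMoyal G₀ (matMoyal (dp μ Q) (dp ν G₀)) u ⊗ₖ fieldStrength A μ ν z) := by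
  obtain ⟨R, hR, hQR, hRQ⟩ := hinv
  have hpoly := isDPolynomial_groenewoldSolution h𝒜 hA hQ hR
  have hreg := fun n => (hpoly n).isRegularFamily hA
  have hsol := solvesGroenewold_groenewoldSolution h𝒜 hA hQ hR hQR
  refine ⟨groenewoldSolution A Q R, hreg, hsol,
    fun G' hG' h' => SolvesGroenewold.eq_of_isRegularFamily h𝒜 hQ hR hRQ hreg hG' hsol h',
    fun n => (hpoly n).exists_fin, R, hR, fun u z => by rw [groenewoldSolution], hQR,
    fun u z => ?_, groenewoldSolution_two h𝒜 hA hQ hR⟩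
  rw [groenewoldSolution_one h𝒜 hA hQ hR]
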